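/- A \emph{d-identity} of a group $G$ is a formula $(f_1=1)\vee\dots\vee(f_m=1)$, where $f_1,\dots,f_m$ are group words in variables $x_0,x_1,x_2,\dots$, such that for every substitution of elements of $G$ for the variables at least one of the equations $f_k=1$ holds; an equation $f=g$ stands for $fg^{-1}=1$. A set $\Delta$ of d-identities of $G$ is a \emph{basis of d-identities of $G$} if every group that satisfies all formulas of $\Delta$ satisfies all d-identities of $G$. For words $f,g$ write $f\in\langle g\rangle$ for $(f=1)\vee(f=g)\vee(f=g^2)\vee(f=g^3)$, and let $$\theta(y_1,y_2,y_3)=\Big[\bigvee_{i\ne j} y_i\in\langle y_j\rangle\Big]\vee\Big[\bigvee_{\sigma\in S_3}y_{\sigma(1)}\in\langle y_{\sigma(2)}y_{\sigma(3)}\rangle\Big]\vee\Big[\bigvee_{\sigma\in S_3}y_{\sigma(1)}y_{\sigma(2)}\in\langle y_{\sigma(2)}y_{\sigma(3)}\rangle\Big].$$ Theorem 2. The following eight formulas form a basis of d-identities of the symmetric group $S_5$: 1. $\omega_{120}=\bigvee_{0\le i<j\le 120}(x_i=x_j)$; 2. $(x^4=1)\vee(x^5=1)\vee(x^6=1)$;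 3. $(x_1^{30}=1)\vee(x_2^{30}=1)\vee((x_1x_2)^{15}=1)\vee((x_1x_2^2)^{15}=1)\vee((x_1x_2^3)^{15}=1)$; 4. with $y_i=x_i^{15}$ and indices $i,j,k\in\{1,2,3\}$, $$\theta(y_1,y_2,y_3)\vee\Big[\bigvee_i y_i=1\Big]\vee\Big[\bigvee_{i\ne j}(y_iy_j)^{15}=1\Big]\vee\Big[\bigvee_{j\ne i\ne k}(y_iy_jy_k)^{15}=1\Big]\vee\Big[\bigvee_{j\ne i\ne k}(y_iy_jy_ky_j)^{15}=1\Big],$$ where $j\ne i\ne k$ means $j\ne i$ and $i\ne k$ (with $j=k$ allowed); 5. $(x_1^{20}=1)\vee(x_2^{20}=1)\vee(x_1^2=x_2^2)\vee((x_1^2x_2^2)^{10}=1)\vee((x_1^4x_2^2)^2=1)$; 6. $(x_1^{15}=1)\vee(x_2^{15}=1)\vee(x_1^4=1)\vee(x_2^4=1)\vee((x_1x_2)^{15}=1)\vee((x_1x_2)^4=1)$; 7. $(x_1^{10}=1)\vee(x_2^{10}=1)\vee(x_1^4=x_2^4)\vee(x_1^6=x_2^6)\vee((x_1^2x_2^2)^3=1)\vee((x_1^2x_2^2)^4=1)\vee((x_1^2x_2^2)^5=1)$;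 8. $(x_1^{12}=1)\vee(x_2^{12}=1)\vee((x_1x_2)^{12}=1)\vee((x_1x_2^2)^{12}=1)\vee((x_1x_2^3)^{12}=1)\vee((x_1x_2^4)^{12}=1)$. -/

import Mathlib

universe u v

namespace DisjunctiveIdentity

/-- Words in the variables `x₀, x₁, x₂, …`: elements of the free group of countable rank. -/
abbrev Word : Type := FreeGroup ℕ

/-- The finite set `{f₁, …, fₘ}` of words stands for the universally quantified disjunction
`∀ x₀ x₁ …, (f₁ = 1) ∨ … ∨ (fₘ = 1)`. -/
abbrev DFormula : Type := Finset Word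

/-- `δ` is a d-identity of `G`: for every substitution of elements of `G` for the variables,
one of the equations `f = 1` with `f ∈ δ` holds. -/
def Satisfies (G : Type u) [Group G] (δ : DFormula) : Prop :=
  ∀ a : ℕ → G, ∃ f ∈ δ, FreeGroup.lift a f = 1

/-- `H` belongs to the d-variety generated by `G`: every d-identity of `G` is one of `H`. -/
def InDVar (G : Type u) [Group G] (H : Type v) [Group H] : Prop :=
  ∀ δ : DFormula, Satisfies G δ → Satisfies H δ

/-- `Δ` is a basis of d-identities of `G`: it consists of d-identities of `G`, and every group
satisfying all of them belongs to the d-variety generated by `G`. -/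
def IsBasisOfDIdentities (G : Type u) [Group G] (Δ : Set DFormula) : Prop :=
  (∀ δ ∈ Δ, Satisfies G δ) ∧
    ∀ (H : Type v) [Group H], (∀ δ ∈ Δ, Satisfies H δ) → InDVar G H

/-- The variable `xᵢ`. -/
def x (i : ℕ) : Word := FreeGroup.of i

/-- The equation `f = g`, written as `f g⁻¹ = 1`. -/
def eqn (f g : Word) : Word := f * g⁻¹

/-- `⋁_{0 ≤ i < j ≤ n} (xᵢ = xⱼ)`. -/
def omega (n : ℕ) : DFormula :=
  ((Finset.range (n + 1) ×ˢ Finset.range (n + 1)).filter fun p => p.1 < p.2).image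
    fun p => eqn (x p.1) (x p.2)

/-- `f ∈ ⟨g⟩` as an abbreviation of `(f = 1) ∨ (f = g) ∨ (f = g²) ∨ (f = g³)`. -/
def memCyc (f g : Word) : DFormula :=
  {f, eqn f g, eqn f (g ^ 2), eqn f (g ^ 3)}

/-- `θ(y₁, y₂, y₃)`, the disjunction of `yᵢ ∈ ⟨yⱼ⟩` for `i ≠ j`, and of
`y_{σ1} ∈ ⟨y_{σ2} y_{σ3}⟩` and `y_{σ1} y_{σ2} ∈ ⟨y_{σ2} y_{σ3}⟩` for `σ ∈ S₃`. -/
def theta (y : Fin 3 → Word) : DFormula :=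
  ((Finset.univ : Finset (Fin 3 × Fin 3)).filter fun p => p.1 ≠ p.2).biUnion
      (fun p => memCyc (y p.1) (y p.2)) ∪
    (Finset.univ : Finset (Equiv.Perm (Fin 3))).biUnion
      (fun σ => memCyc (y (σ 0)) (y (σ 1) * y (σ 2))) ∪
    (Finset.univ : Finset (Equiv.Perm (Fin 3))).biUnion
      (fun σ => memCyc (y (σ 0) * y (σ 1)) (y (σ 1) * y (σ 2)))

/-- `(x⁴ = 1) ∨ (x⁵ = 1) ∨ (x⁶ = 1)`. -/
def exponents456 : DFormula :=
  {x 1 ^ 4, x 1 ^ 5, x 1 ^ 6}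

/-- `(x₁³⁰ = 1) ∨ (x₂³⁰ = 1) ∨ ((x₁x₂)¹⁵ = 1) ∨ ((x₁x₂²)¹⁵ = 1) ∨ ((x₁x₂³)¹⁵ = 1)`. -/
def fourCycles : DFormula :=
  {x 1 ^ 30, x 2 ^ 30, (x 1 * x 2) ^ 15, (x 1 * x 2 ^ 2) ^ 15, (x 1 * x 2 ^ 3) ^ 15}

/-- With `yᵢ = xᵢ¹⁵` for `i = 1, 2, 3`, the disjunction of `θ(y₁, y₂, y₃)`, of `yᵢ = 1`, of
`(yᵢyⱼ)¹⁵ = 1` for `i ≠ j`, and of `(yᵢyⱼyₖ)¹⁵ = 1` and `(yᵢyⱼyₖyⱼ)¹⁵ = 1` for `j ≠ i ≠ k`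
(where `j = k` is allowed). -/
def elementaryAbelian8 : DFormula :=
  let y : Fin 3 → Word := fun i => x (i.val + 1) ^ 15
  let triples : Finset (Fin 3 × Fin 3 × Fin 3) :=
    Finset.univ.filter fun t => t.2.1 ≠ t.1 ∧ t.1 ≠ t.2.2
  theta y ∪
    Finset.univ.image y ∪
    ((Finset.univ : Finset (Fin 3 × Fin 3)).filter fun p => p.1 ≠ p.2).image
      (fun p => (y p.1 * y p.2) ^ 15) ∪
    triples.image (fun t => (y t.1 * y t.2.1 * y t.2.2) ^ 15) ∪
    triples.image (fun t => (y t.1 * y t.2.1 * y t.2.2 * y t.2.1) ^ 15)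

/-- `(x₁²⁰ = 1) ∨ (x₂²⁰ = 1) ∨ (x₁² = x₂²) ∨ ((x₁²x₂²)¹⁰ = 1) ∨ ((x₁⁴x₂²)² = 1)`. -/
def order9 : DFormula :=
  {x 1 ^ 20, x 2 ^ 20, eqn (x 1 ^ 2) (x 2 ^ 2), (x 1 ^ 2 * x 2 ^ 2) ^ 10,
    (x 1 ^ 4 * x 2 ^ 2) ^ 2}

/-- `(x₁¹⁵ = 1) ∨ (x₂¹⁵ = 1) ∨ (x₁⁴ = 1) ∨ (x₂⁴ = 1) ∨ ((x₁x₂)¹⁵ = 1) ∨ ((x₁x₂)⁴ = 1)`. -/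
def abelian12 : DFormula :=
  {x 1 ^ 15, x 2 ^ 15, x 1 ^ 4, x 2 ^ 4, (x 1 * x 2) ^ 15, (x 1 * x 2) ^ 4}

/-- `(x₁¹⁰ = 1) ∨ (x₂¹⁰ = 1) ∨ (x₁⁴ = x₂⁴) ∨ (x₁⁶ = x₂⁶) ∨ ((x₁²x₂²)³ = 1)
∨ ((x₁²x₂²)⁴ = 1) ∨ ((x₁²x₂²)⁵ = 1)`. -/
def dicyclic12 : DFormula :=
  {x 1 ^ 10, x 2 ^ 10, eqn (x 1 ^ 4) (x 2 ^ 4), eqn (x 1 ^ 6) (x 2 ^ 6),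
    (x 1 ^ 2 * x 2 ^ 2) ^ 3, (x 1 ^ 2 * x 2 ^ 2) ^ 4, (x 1 ^ 2 * x 2 ^ 2) ^ 5}

/-- `(x₁¹² = 1) ∨ (x₂¹² = 1) ∨ ((x₁x₂)¹² = 1) ∨ ((x₁x₂²)¹² = 1) ∨ ((x₁x₂³)¹² = 1)
∨ ((x₁x₂⁴)¹² = 1)`. -/
def order25 : DFormula :=
  {x 1 ^ 12, x 2 ^ 12, (x 1 * x 2) ^ 12, (x 1 * x 2 ^ 2) ^ 12, (x 1 * x 2 ^ 3) ^ 12,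
    (x 1 * x 2 ^ 4) ^ 12}

end DisjunctiveIdentity

namespace DisjunctiveIdentity

open Equiv

/-! ### Permutations of five points as natural numbers -/

/-! A group that embeds in $S_5$ satisfies every d-identity of $S_5$ (`Embeds.inDVar`). So it
suffices to check the eight formulas in $S_5$ and to show that every group $G$ satisfying them
embeds in $S_5$ (`IsModel.embeds`). The check is a finite computation on permutations encoded as
numbers, with the first variable restricted to representatives of the conjugacy classes.

For the embedding, `omega` makes $G$ finite and `exponents456` bounds the orders of elements. The
formulas pass to subgroups, so they can be applied to $p$-subgroups: `order25` and `order9` force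
5-subgroups and 3-subgroups to be trivial or of prime order, while `fourCycles` and
`elementaryAbelian8` bound 2-subgroups by 8. Hence $|G|$ divides 120 (`IsModel.card_dvd`). What
remains is to find a faithful action on at most five points.

If 5 divides $|G|$, elements of order 5 are self-centralizing and there are one or six Sylow
5-subgroups. In the first case $G$ acts faithfully on the cosets of a Sylow 2-subgroup. In the
second it embeds in $S_6$, and order 30 is impossible. For orders 60 and 120 the image has index 6
and trivial core in $A_6$ or $S_6$, so it acts faithfully on the five cosets other than itself; this
covers the exotic transitive embeddings in $S_6$.

If $|G|$ divides 24 and exceeds 5, it is 6, 8, 12 or 24. Here `dicyclic12` forbids an element of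
order 3 from commuting with the square of an element of order 4, and `abelian12` forbids $C_2\times
C_2\times C_3$. With `fourCycles` this leaves groups acting faithfully on one coset space or on a
disjoint union of two. -/

/-- The permutation `σ` of `Fin 5` is encoded by the number whose octal digits are its values. -/
def code (σ : Perm (Fin 5)) : ℕ :=
  σ 0 + 8 * σ 1 + 64 * σ 2 + 512 * σ 3 + 4096 * σ 4

/-- The `i`-th octal digit of `p`. -/
def digit (p i : ℕ) : ℕ := p / 8 ^ i % 8

/-- Composition of encoded permutations. -/
def codeMul (p q : ℕ) : ℕ :=
  digit p (digit q 0) + 8 * digit p (digit q 1) + 64 * digit p (digit q 2) +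
    512 * digit p (digit q 3) + 4096 * digit p (digit q 4)

/-- The code of the identity. -/
def codeOne : ℕ := 18056

/-- Powers of encoded permutations. -/
def codePow (p : ℕ) : ℕ → ℕ
  | 0 => codeOne
  | n + 1 => codeMul (codePow p n) p

theorem digit_code (σ : Perm (Fin 5)) (i : Fin 5) : digit (code σ) i = σ i := by
  have h0 := (σ 0).isLt
  have h1 := (σ 1).isLt
  have h2 := (σ 2).isLt
  have h3 := (σ 3).isLt
  have h4 := (σ 4).isLt
  unfold digit code
  fin_cases i <;> simp <;> omega

theorem code_injective : Function.Injective code := fun σ τ h => by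
  ext i
  rw [← digit_code, ← digit_code, h]

theorem code_mul (σ τ : Perm (Fin 5)) : code (σ * τ) = codeMul (code σ) (code τ) := by
  have h (i : Fin 5) : digit (code σ) (digit (code τ) i) = σ (τ i) := by
    rw [digit_code, digit_code]
  have h0 := h 0
  have h1 := h 1
  have h2 := h 2
  have h3 := h 3
  have h4 := h 4
  simp only [Fin.val_zero, Fin.val_one, Fin.val_two] at h0 h1 h2
  change digit (code σ) (digit (code τ) 3) = _ at h3
  change digit (code σ) (digit (code τ) 4) = _ at h4
  rw [codeMul, h0, h1, h2, h3, h4]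
  rfl

theorem code_one : code 1 = codeOne := by
  simp [code, codeOne]

theorem code_pow (σ : Perm (Fin 5)) (n : ℕ) : code (σ ^ n) = codePow (code σ) n := by
  induction n with
  | zero => exact code_one
  | succ n ih => rw [pow_succ, code_mul, ih, codePow]

/-- The codes of all permutations of `Fin 5`. -/
def codes : List ℕ :=
  [668, 675, 724, 738, 787, 794, 1116, 1123, 1228, 1249, 1291, 1305, 1620, 1634, 1676, 1697,
   1802, 1809, 2131, 2138, 2187, 2201, 2250, 2257, 4252, 4259, 4308, 4322, 4371, 4378, 5148,
   5155, 5316, 5344, 5379, 5400, 5652, 5666, 5764, 5792, 5890, 5904, 6163, 6170, 6275, 6296,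
   6338, 6352, 8284, 8291, 8396, 8417, 8459, 8473, 8732, 8739, 8900, 8928, 8963, 8984, 9740,
   9761, 9796, 9824, 9985, 9992, 10251, 10265, 10307, 10328, 10433, 10440, 12372, 12386,
   12428, 12449, 12554, 12561, 12820, 12834, 12932, 12960, 13058, 13072, 13324, 13345,
   13380, 13408, 13569, 13576, 14346, 14353, 14402, 14416, 14465, 14472, 16467, 16474,
   16523, 16537, 16586, 16593, 16915, 16922, 17027, 17048, 17090, 17104, 17419, 17433,
   17475, 17496, 17601, 17608, 17930, 17937, 17986, 18000, 18049, 18056]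

/-- Codes of representatives of the conjugacy classes of permutations of `Fin 5`. -/
def classCodes : List ℕ :=
  [18056, 18049, 17601, 17937, 16593, 2257, 14353]

theorem code_mem_codes (σ : Perm (Fin 5)) : code σ ∈ codes := by
  revert σ
  decide +kernel

/-- Counting: the 120 distinct values of `code` lie in a list of length at most 120, so they exhaust
it. -/
theorem exists_code_eq {p : ℕ} (hp : p ∈ codes) : ∃ σ, code σ = p := by
  have h : Finset.univ.image code = codes.toFinset := by
    refine Finset.eq_of_subset_of_card_le ?_ ?_
    · intro p hp
      obtain ⟨σ, -, rfl⟩ := Finset.mem_image.1 hp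
      exact List.mem_toFinset.2 (code_mem_codes σ)
    · rw [Finset.card_image_of_injective _ code_injective, Finset.card_univ, Fintype.card_perm]
      exact (List.toFinset_card_le _).trans (by decide +kernel)
  rw [← List.mem_toFinset, ← h] at hp
  simpa using hp

theorem exists_conj_mem_classCodes (σ : Perm (Fin 5)) :
    ∃ g : Perm (Fin 5), code (g * σ * g⁻¹) ∈ classCodes := by
  -- Conjugacy $gpg^{-1}=r$ is tested as $gp=rg$, so inverses need no encoding.
  have h : ∀ p ∈ codes, ∃ g ∈ codes, ∃ r ∈ classCodes, r ∈ codes ∧ codeMul g p = codeMul r g := by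
    decide +kernel
  obtain ⟨g, hg, r, hr, hr', e⟩ := h _ (code_mem_codes σ)
  obtain ⟨g, rfl⟩ := exists_code_eq hg
  obtain ⟨r, rfl⟩ := exists_code_eq hr'
  rw [← code_mul, ← code_mul] at e
  refine ⟨g, ?_⟩
  rwa [code_injective e, mul_inv_cancel_right]

/-- To check a formula in `S₅` one may replace `x₁` by a conjugate. -/
theorem satisfies_of_classCodes {δ : DFormula}
    (h : ∀ a : ℕ → Perm (Fin 5), code (a 1) ∈ classCodes → ∃ f ∈ δ, FreeGroup.lift a f = 1) :
    Satisfies (Perm (Fin 5)) δ := by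
  intro a
  obtain ⟨g, hg⟩ := exists_conj_mem_classCodes (a 1)
  obtain ⟨f, hf, e⟩ := h (fun i => g * a i * g⁻¹) hg
  refine ⟨f, hf, ?_⟩
  have key : FreeGroup.lift (fun i => g * a i * g⁻¹) =
      (MulAut.conj g).toMonoidHom.comp (FreeGroup.lift a) := by
    ext; simp
  rw [key] at e
  simpa using e

/-! ### The eight formulas hold in `S₅` -/

/-- The set `elementaryAbelian8` in terms of the words `yᵢ`. -/
theorem mem_elementaryAbelian8 {f : Word} {y : Fin 3 → Word}
    (hy : y = fun i => x (i.val + 1) ^ 15) :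
    f ∈ elementaryAbelian8 ↔
      (∃ i j, i ≠ j ∧ f ∈ memCyc (y i) (y j)) ∨
      (∃ σ : Perm (Fin 3), f ∈ memCyc (y (σ 0)) (y (σ 1) * y (σ 2))) ∨
      (∃ σ : Perm (Fin 3), f ∈ memCyc (y (σ 0) * y (σ 1)) (y (σ 1) * y (σ 2))) ∨
      (∃ i, y i = f) ∨ (∃ i j, i ≠ j ∧ (y i * y j) ^ 15 = f) ∨
      (∃ i j k, (j ≠ i ∧ i ≠ k) ∧ (y i * y j * y k) ^ 15 = f) ∨
      (∃ i j k, (j ≠ i ∧ i ≠ k) ∧ (y i * y j * y k * y j) ^ 15 = f) := by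
  subst hy
  simp only [elementaryAbelian8, theta, Finset.mem_union, Finset.mem_biUnion, Finset.mem_filter,
    Finset.mem_univ, true_and, Finset.mem_image, Prod.exists, or_assoc]

theorem exists_perm_fin_three {i j k : Fin 3} (hij : i ≠ j) (hik : i ≠ k) (hjk : j ≠ k) :
    ∃ σ : Perm (Fin 3), σ 0 = i ∧ σ 1 = j ∧ σ 2 = k := by
  revert i j k
  decide

theorem lift_x {G : Type*} [Group G] (a : ℕ → G) (i : ℕ) : FreeGroup.lift a (x i) = a i := by
  simp [x]

theorem lift_eqn {G : Type*} [Group G] (a : ℕ → G) (f g : Word) :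
    FreeGroup.lift a (eqn f g) = 1 ↔ FreeGroup.lift a f = FreeGroup.lift a g := by
  simp [eqn, mul_inv_eq_one]

theorem exists_mem_exponents456 {G : Type*} [Group G] (a : ℕ → G) :
    (∃ f ∈ exponents456, FreeGroup.lift a f = 1) ↔
      a 1 ^ 4 = 1 ∨ a 1 ^ 5 = 1 ∨ a 1 ^ 6 = 1 := by
  simp only [exponents456, Finset.mem_insert, Finset.mem_singleton, exists_eq_or_imp, exists_eq_left,
    map_pow, lift_x]

theorem exists_mem_fourCycles {G : Type*} [Group G] (a : ℕ → G) :
    (∃ f ∈ fourCycles, FreeGroup.lift a f = 1) ↔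
      a 1 ^ 30 = 1 ∨ a 2 ^ 30 = 1 ∨ (a 1 * a 2) ^ 15 = 1 ∨ (a 1 * a 2 ^ 2) ^ 15 = 1 ∨
      (a 1 * a 2 ^ 3) ^ 15 = 1 := by
  simp only [fourCycles, Finset.mem_insert, Finset.mem_singleton, exists_eq_or_imp, exists_eq_left,
    map_pow, map_mul, lift_x]

theorem exists_mem_order9 {G : Type*} [Group G] (a : ℕ → G) :
    (∃ f ∈ order9, FreeGroup.lift a f = 1) ↔
      a 1 ^ 20 = 1 ∨ a 2 ^ 20 = 1 ∨ a 1 ^ 2 = a 2 ^ 2 ∨ (a 1 ^ 2 * a 2 ^ 2) ^ 10 = 1 ∨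
      (a 1 ^ 4 * a 2 ^ 2) ^ 2 = 1 := by
  simp only [order9, Finset.mem_insert, Finset.mem_singleton, exists_eq_or_imp, exists_eq_left,
    map_pow, map_mul, lift_x, lift_eqn]

theorem exists_mem_abelian12 {G : Type*} [Group G] (a : ℕ → G) :
    (∃ f ∈ abelian12, FreeGroup.lift a f = 1) ↔
      a 1 ^ 15 = 1 ∨ a 2 ^ 15 = 1 ∨ a 1 ^ 4 = 1 ∨ a 2 ^ 4 = 1 ∨ (a 1 * a 2) ^ 15 = 1 ∨
      (a 1 * a 2) ^ 4 = 1 := by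
  simp only [abelian12, Finset.mem_insert, Finset.mem_singleton, exists_eq_or_imp, exists_eq_left,
    map_pow, map_mul, lift_x]

theorem exists_mem_dicyclic12 {G : Type*} [Group G] (a : ℕ → G) :
    (∃ f ∈ dicyclic12, FreeGroup.lift a f = 1) ↔
      a 1 ^ 10 = 1 ∨ a 2 ^ 10 = 1 ∨ a 1 ^ 4 = a 2 ^ 4 ∨ a 1 ^ 6 = a 2 ^ 6 ∨
      (a 1 ^ 2 * a 2 ^ 2) ^ 3 = 1 ∨ (a 1 ^ 2 * a 2 ^ 2) ^ 4 = 1 ∨ (a 1 ^ 2 * a 2 ^ 2) ^ 5 = 1 := by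
  simp only [dicyclic12, Finset.mem_insert, Finset.mem_singleton, exists_eq_or_imp, exists_eq_left,
    map_pow, map_mul, lift_x, lift_eqn]

theorem exists_mem_order25 {G : Type*} [Group G] (a : ℕ → G) :
    (∃ f ∈ order25, FreeGroup.lift a f = 1) ↔
      a 1 ^ 12 = 1 ∨ a 2 ^ 12 = 1 ∨ (a 1 * a 2) ^ 12 = 1 ∨ (a 1 * a 2 ^ 2) ^ 12 = 1 ∨
      (a 1 * a 2 ^ 3) ^ 12 = 1 ∨ (a 1 * a 2 ^ 4) ^ 12 = 1 := by
  simp only [order25, Finset.mem_insert, Finset.mem_singleton, exists_eq_or_imp, exists_eq_left,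
    map_pow, map_mul, lift_x]

theorem satisfies_omega : Satisfies (Perm (Fin 5)) (omega 120) := by
  intro a
  obtain ⟨i, j, hij, e⟩ : ∃ i j : Fin 121, i < j ∧ a i = a j := by
    obtain ⟨i, j, hij, e⟩ := Fintype.exists_ne_map_eq_of_card_lt (fun i : Fin 121 => a i)
      (by rw [Fintype.card_perm, Fintype.card_fin, Fintype.card_fin]; decide)
    rcases lt_or_gt_of_ne hij with h | h
    · exact ⟨i, j, h, e⟩
    · exact ⟨j, i, h, e.symm⟩
  refine ⟨eqn (x i) (x j), ?_, ?_⟩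
  · simp only [omega, Finset.mem_image, Finset.mem_filter, Finset.mem_product, Finset.mem_range,
      Prod.exists]
    exact ⟨i, j, ⟨⟨i.isLt, j.isLt⟩, hij⟩, rfl⟩
  · rw [lift_eqn, lift_x, lift_x, e]

theorem satisfies_exponents456 : Satisfies (Perm (Fin 5)) exponents456 := by
  have key : ∀ p ∈ classCodes,
      codePow p 4 = codeOne ∨ codePow p 5 = codeOne ∨ codePow p 6 = codeOne := by
    decide +kernel
  refine satisfies_of_classCodes fun a ha => ?_
  rw [exists_mem_exponents456]
  simpa only [← code_injective.eq_iff, code_pow, code_one] using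
    key _ ha

theorem satisfies_fourCycles : Satisfies (Perm (Fin 5)) fourCycles := by
  -- The disjunct involving only `p` stands before the quantifier over `q`, so that most classes are
  -- settled without a search.
  have key : ∀ p ∈ classCodes, codePow p 30 = codeOne ∨ ∀ q ∈ codes,
      codePow q 30 = codeOne ∨ codePow (codeMul p q) 15 = codeOne ∨
      codePow (codeMul p (codePow q 2)) 15 = codeOne ∨
      codePow (codeMul p (codePow q 3)) 15 = codeOne := by
    decide +kernel
  refine satisfies_of_classCodes fun a ha => ?_
  rw [exists_mem_fourCycles]
  simpa only [← code_injective.eq_iff, code_pow, code_one, code_mul] using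
    (key _ ha).imp_right fun h => h _ (code_mem_codes (a 2))

theorem satisfies_order9 : Satisfies (Perm (Fin 5)) order9 := by
  have key : ∀ p ∈ classCodes, codePow p 20 = codeOne ∨ ∀ q ∈ codes,
      codePow q 20 = codeOne ∨ codePow p 2 = codePow q 2 ∨
      codePow (codeMul (codePow p 2) (codePow q 2)) 10 = codeOne ∨
      codePow (codeMul (codePow p 4) (codePow q 2)) 2 = codeOne := by
    decide +kernel
  refine satisfies_of_classCodes fun a ha => ?_
  rw [exists_mem_order9]
  simpa only [← code_injective.eq_iff, code_pow, code_one, code_mul] using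
    (key _ ha).imp_right fun h => h _ (code_mem_codes (a 2))

theorem satisfies_abelian12 : Satisfies (Perm (Fin 5)) abelian12 := by
  have key : ∀ p ∈ classCodes, codePow p 15 = codeOne ∨ codePow p 4 = codeOne ∨ ∀ q ∈ codes,
      codePow q 15 = codeOne ∨ codePow q 4 = codeOne ∨ codePow (codeMul p q) 15 = codeOne ∨
      codePow (codeMul p q) 4 = codeOne := by
    decide +kernel
  refine satisfies_of_classCodes fun a ha => ?_
  rw [exists_mem_abelian12]
  simp only [← code_injective.eq_iff, code_pow, code_one, code_mul]
  rcases key _ ha with h | h | h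
  · exact .inl h
  · exact .inr (.inr (.inl h))
  · rcases h _ (code_mem_codes (a 2)) with h | h | h | h
    · exact .inr (.inl h)
    · exact .inr (.inr (.inr (.inl h)))
    · exact .inr (.inr (.inr (.inr (.inl h))))
    · exact .inr (.inr (.inr (.inr (.inr h))))

theorem satisfies_dicyclic12 : Satisfies (Perm (Fin 5)) dicyclic12 := by
  have key : ∀ p ∈ classCodes, codePow p 10 = codeOne ∨ ∀ q ∈ codes,
      codePow q 10 = codeOne ∨ codePow p 4 = codePow q 4 ∨ codePow p 6 = codePow q 6 ∨
      codePow (codeMul (codePow p 2) (codePow q 2)) 3 = codeOne ∨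
      codePow (codeMul (codePow p 2) (codePow q 2)) 4 = codeOne ∨
      codePow (codeMul (codePow p 2) (codePow q 2)) 5 = codeOne := by
    decide +kernel
  refine satisfies_of_classCodes fun a ha => ?_
  rw [exists_mem_dicyclic12]
  simpa only [← code_injective.eq_iff, code_pow, code_one, code_mul] using
    (key _ ha).imp_right fun h => h _ (code_mem_codes (a 2))

theorem satisfies_order25 : Satisfies (Perm (Fin 5)) order25 := by
  have key : ∀ p ∈ classCodes, codePow p 12 = codeOne ∨ ∀ q ∈ codes,
      codePow q 12 = codeOne ∨ codePow (codeMul p q) 12 = codeOne ∨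
      codePow (codeMul p (codePow q 2)) 12 = codeOne ∨
      codePow (codeMul p (codePow q 3)) 12 = codeOne ∨
      codePow (codeMul p (codePow q 4)) 12 = codeOne := by
    decide +kernel
  refine satisfies_of_classCodes fun a ha => ?_
  rw [exists_mem_order25]
  simpa only [← code_injective.eq_iff, code_pow, code_one, code_mul] using
    (key _ ha).imp_right fun h => h _ (code_mem_codes (a 2))

/-- The codes of the permutations of `Fin 5` whose order is a power of two. -/
def twoCodes : List ℕ :=
  [668, 675, 1228, 1291, 1620, 1634, 1676, 1809, 2201, 2250, 4252, 4259, 5344, 5400, 5652,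
   5666, 5792, 5890, 6275, 6352, 8396, 8459, 8928, 8984, 9761, 9796, 9985, 9992, 10251,
   10328, 12449, 12554, 12932, 13072, 13324, 13408, 14346, 14416, 14465, 14472, 16467,
   16474, 16523, 16593, 16915, 16922, 17048, 17090, 17433, 17475, 17601, 17608, 17930,
   18000, 18049, 18056]

theorem code_pow_fifteen_mem_twoCodes (σ : Perm (Fin 5)) : code (σ ^ 15) ∈ twoCodes := by
  have key : ∀ p ∈ codes, codePow p 15 ∈ twoCodes := by decide +kernel
  rw [code_pow]
  exact key _ (code_mem_codes σ)

theorem satisfies_elementaryAbelian8 : Satisfies (Perm (Fin 5)) elementaryAbelian8 := by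
  -- Here $y_1=r^{15}$, $y_2=q$, $y_3=s$. A selection of the disjuncts already covers all triples,
  -- and those free of $y_3$ are tested before `s` is introduced. Letting `q` and `s` run through
  -- `twoCodes` replaces taking 15th powers of all permutations.
  have key : ∀ r ∈ classCodes, codePow r 15 = codeOne ∨ ∀ q ∈ twoCodes,
      codePow (codeMul (codePow r 15) q) 15 = codeOne ∨
      codePow r 15 = codePow q 2 ∨ q = codePow (codePow r 15) 2 ∨
      ∀ s ∈ twoCodes,
      codePow (codeMul (codePow r 15) s) 15 = codeOne ∨
      codePow r 15 = codePow s 2 ∨ s = codePow (codePow r 15) 2 ∨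
      codePow (codeMul q s) 15 = codeOne ∨ q = codePow s 2 ∨ s = codePow q 2 ∨
      codePow r 15 = codePow (codeMul s q) 2 ∨ q = codePow (codeMul s (codePow r 15)) 2 ∨
      s = codePow (codeMul q (codePow r 15)) 2 ∨
      codeMul q s = codePow (codeMul s (codePow r 15)) 3 ∨
      codeMul s (codePow r 15) = codePow (codeMul (codePow r 15) q) 3 ∨
      codeMul s q = codePow (codeMul q (codePow r 15)) 3 ∨
      codePow (codeMul (codeMul s (codePow r 15)) q) 15 = codeOne ∨
      codePow (codeMul (codeMul s q) (codePow r 15)) 15 = codeOne ∨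
      codePow (codeMul (codeMul (codeMul q s) (codePow r 15)) s) 15 = codeOne ∨
      codePow (codeMul (codeMul (codeMul s (codePow r 15)) q) (codePow r 15)) 15 = codeOne ∨
      codePow (codeMul (codeMul (codeMul s q) (codePow r 15)) q) 15 = codeOne := by
    decide +kernel
  refine satisfies_of_classCodes fun a ha => ?_
  by_contra! h
  obtain ⟨y, hy⟩ : ∃ y : Fin 3 → Word, y = fun i => x (i.val + 1) ^ 15 := ⟨_, rfl⟩
  obtain ⟨Y, hY⟩ : ∃ Y : Fin 3 → Perm (Fin 5), ∀ i, Y i = FreeGroup.lift a (y i) :=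
    ⟨_, fun _ => rfl⟩
  have hcode (i : Fin 3) : code (Y i) ∈ twoCodes := by
    simpa [hY, hy, lift_x] using code_pow_fifteen_mem_twoCodes (a (i + 1))
  have h0 : codePow (code (a 1)) 15 = code (Y 0) := by simp [hY, hy, lift_x, code_pow]
  simp only [mem_elementaryAbelian8 hy] at h
  have one : Y 0 ≠ 1 := by
    rw [hY]
    exact h _ (.inr <| .inr <| .inr <| .inl ⟨0, rfl⟩)
  have sq {i j : Fin 3} (hij : i ≠ j) : Y i ≠ Y j ^ 2 := by
    rw [hY, hY, ← map_pow, Ne, ← lift_eqn]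
    exact h _ (.inl ⟨i, j, hij, by simp [memCyc]⟩)
  have sq_mul {i j k : Fin 3} (hij : i ≠ j) (hik : i ≠ k) (hjk : j ≠ k) :
      Y i ≠ (Y j * Y k) ^ 2 := by
    obtain ⟨σ, rfl, rfl, rfl⟩ := exists_perm_fin_three hij hik hjk
    rw [hY, hY, hY, ← map_mul, ← map_pow, Ne, ← lift_eqn]
    exact h _ (.inr <| .inl ⟨σ, by simp [memCyc]⟩)
  have mul_cube {i j k : Fin 3} (hij : i ≠ j) (hik : i ≠ k) (hjk : j ≠ k) :
      Y i * Y j ≠ (Y j * Y k) ^ 3 := by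
    obtain ⟨σ, rfl, rfl, rfl⟩ := exists_perm_fin_three hij hik hjk
    rw [hY, hY, hY, ← map_mul, ← map_mul, ← map_pow, Ne, ← lift_eqn]
    exact h _ (.inr <| .inr <| .inl ⟨σ, by simp [memCyc]⟩)
  have two {i j : Fin 3} (hij : i ≠ j) : (Y i * Y j) ^ 15 ≠ 1 := by
    rw [hY, hY, ← map_mul, ← map_pow]
    exact h _ (.inr <| .inr <| .inr <| .inr <| .inl ⟨i, j, hij, rfl⟩)
  have three {i j k : Fin 3} (hij : j ≠ i) (hik : i ≠ k) : (Y i * Y j * Y k) ^ 15 ≠ 1 := by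
    rw [hY, hY, hY, ← map_mul, ← map_mul, ← map_pow]
    exact h _ (.inr <| .inr <| .inr <| .inr <| .inr <| .inl ⟨i, j, k, ⟨hij, hik⟩, rfl⟩)
  have four {i j k : Fin 3} (hij : j ≠ i) (hik : i ≠ k) :
      (Y i * Y j * Y k * Y j) ^ 15 ≠ 1 := by
    rw [hY, hY, hY, ← map_mul, ← map_mul, ← map_mul, ← map_pow]
    exact h _ (.inr <| .inr <| .inr <| .inr <| .inr <| .inr ⟨i, j, k, ⟨hij, hik⟩, rfl⟩)
  have key := key _ ha
  rw [h0] at key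
  have key := (key.resolve_left (by rwa [← code_one, code_injective.eq_iff])) _ (hcode 1)
  simp only [← code_mul, ← code_pow, ← code_one, code_injective.eq_iff] at key
  rcases key with h | h | h | h
  · exact two (by decide) h
  · exact sq (by decide) h
  · exact sq (by decide) h
  have key := h _ (hcode 2)
  simp only [← code_mul, ← code_pow, code_injective.eq_iff] at key
  rcases key with h | h | h | h | h | h | h | h | h | h | h | h | h | h | h | h | h
  · exact two (by decide) h
  · exact sq (by decide) h
  · exact sq (by decide) h
  · exact two (by decide) h
  · exact sq (by decide) h
  · exact sq (by decide) h
  · exact sq_mul (by decide) (by decide) (by decide) h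
  · exact sq_mul (by decide) (by decide) (by decide) h
  · exact sq_mul (by decide) (by decide) (by decide) h
  · exact mul_cube (by decide) (by decide) (by decide) h
  · exact mul_cube (by decide) (by decide) (by decide) h
  · exact mul_cube (by decide) (by decide) (by decide) h
  · exact three (by decide) (by decide) h
  · exact three (by decide) (by decide) h
  · exact four (by decide) (by decide) h
  · exact four (by decide) (by decide) h
  · exact four (by decide) (by decide) h

/-! ### Consequences of the formulas -/

/-- The formulas of the basis, as properties of the elements of a group. -/
structure IsModel (G : Type*) [Group G] : Prop where
  finite : Finite G
  card_le : Nat.card G ≤ 120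
  exponents : ∀ a : G, a ^ 4 = 1 ∨ a ^ 5 = 1 ∨ a ^ 6 = 1
  fourCycles : ∀ a b : G, a ^ 30 = 1 ∨ b ^ 30 = 1 ∨ (a * b) ^ 15 = 1 ∨ (a * b ^ 2) ^ 15 = 1 ∨
    (a * b ^ 3) ^ 15 = 1
  -- Only the consequence of `elementaryAbelian8` for commuting elements of square one is kept:
  -- there is no elementary abelian subgroup of order 8.
  elementaryAbelian : ∀ a b c : G, a ^ 2 = 1 → b ^ 2 = 1 → c ^ 2 = 1 →
    Commute a b → Commute a c → Commute b c →
    a = 1 ∨ b = 1 ∨ c = 1 ∨ a = b ∨ a = c ∨ b = c ∨ c = a * b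
  order9 : ∀ a b : G, a ^ 20 = 1 ∨ b ^ 20 = 1 ∨ a ^ 2 = b ^ 2 ∨ (a ^ 2 * b ^ 2) ^ 10 = 1 ∨
    (a ^ 4 * b ^ 2) ^ 2 = 1
  abelian12 : ∀ a b : G, a ^ 15 = 1 ∨ b ^ 15 = 1 ∨ a ^ 4 = 1 ∨ b ^ 4 = 1 ∨ (a * b) ^ 15 = 1 ∨
    (a * b) ^ 4 = 1
  dicyclic12 : ∀ a b : G, a ^ 10 = 1 ∨ b ^ 10 = 1 ∨ a ^ 4 = b ^ 4 ∨ a ^ 6 = b ^ 6 ∨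
    (a ^ 2 * b ^ 2) ^ 3 = 1 ∨ (a ^ 2 * b ^ 2) ^ 4 = 1 ∨ (a ^ 2 * b ^ 2) ^ 5 = 1
  order25 : ∀ a b : G, a ^ 12 = 1 ∨ b ^ 12 = 1 ∨ (a * b) ^ 12 = 1 ∨ (a * b ^ 2) ^ 12 = 1 ∨
    (a * b ^ 3) ^ 12 = 1 ∨ (a * b ^ 4) ^ 12 = 1

theorem finite_and_card_le_of_satisfies_omega {G : Type*} [Group G] {n : ℕ}
    (h : Satisfies G (omega n)) : Finite G ∧ Nat.card G ≤ n := by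
  have key (s : Finset G) : s.card ≤ n := by
    by_contra! hs
    obtain ⟨e⟩ : Nonempty (Fin (n + 1) ↪ s) :=
      Function.Embedding.nonempty_of_card_le (by simpa using hs)
    -- Reduction modulo $n+1$ only affects variables beyond $x_n$, which do not occur in the
    -- formula.
    obtain ⟨f, hf, e1⟩ := h fun i => e (Fin.ofNat (n + 1) i)
    simp only [omega, Finset.mem_image, Finset.mem_filter, Finset.mem_product, Finset.mem_range,
      Prod.exists] at hf
    obtain ⟨i, j, ⟨⟨hi, hj⟩, hij⟩, rfl⟩ := hf
    rw [lift_eqn, lift_x, lift_x] at e1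
    have := congrArg Fin.val (e.injective (Subtype.ext e1))
    simp only [Fin.val_ofNat, Nat.mod_eq_of_lt hi, Nat.mod_eq_of_lt hj] at this
    omega
  have hfin : Finite G := by
    by_contra hG
    rw [not_finite_iff_infinite] at hG
    obtain ⟨s, hs⟩ := Infinite.exists_subset_card_eq G (n + 1)
    have := key s
    omega
  refine ⟨hfin, ?_⟩
  have := Fintype.ofFinite G
  rw [Nat.card_eq_fintype_card]
  exact key Finset.univ

theorem pow_eq_self_of_sq_eq_one {G : Type*} [Group G] {a : G} (h : a ^ 2 = 1) (n : ℕ) :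
    a ^ (2 * n + 1) = a := by
  rw [pow_succ, pow_mul, h, one_pow, one_mul]

/-- On commuting elements of square one, 15th powers and cubes change nothing and squares vanish.
Every equation of the formula therefore collapses to one of the three listed kinds. -/
theorem elementaryAbelian_of_satisfies {G : Type*} [Group G]
    (h : Satisfies G elementaryAbelian8) {y : Fin 3 → G} (hy : ∀ i, y i ^ 2 = 1)
    (hcomm : ∀ i j, Commute (y i) (y j)) :
    (∃ i, y i = 1) ∨ (∃ i j, i ≠ j ∧ y i = y j) ∨
      ∃ i j k, i ≠ j ∧ i ≠ k ∧ j ≠ k ∧ y i = y j * y k := by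
  by_contra! hne
  obtain ⟨h1, h2, h3⟩ := hne
  -- The shift matches the variables $x_1,x_2,x_3$ with the indices $0,1,2$; the value at $x_0$ is
  -- irrelevant.
  obtain ⟨f, hf, e⟩ := h fun n => y (Fin.ofNat 3 (n - 1))
  set L := FreeGroup.lift fun n => y (Fin.ofNat 3 (n - 1)) with hL
  obtain ⟨w, hw⟩ : ∃ w : Fin 3 → Word, w = fun i => x (i.val + 1) ^ 15 := ⟨_, rfl⟩
  have hw' (i) : L (w i) = y i := by
    simp [hw, hL, lift_x, pow_eq_self_of_sq_eq_one (hy i) 7]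
  have hinv (i) : (y i)⁻¹ = y i := inv_eq_of_mul_eq_one_left (by rw [← sq, hy])
  have hmul (i j) : (y i * y j) ^ 2 = 1 := by rw [(hcomm i j).mul_pow, hy, hy, one_mul]
  have hmul' (i j k) : (y i * y j * y k) ^ 2 = 1 := by
    rw [((hcomm i k).mul_left (hcomm j k)).mul_pow, hmul, hy, one_mul]
  have hcyc {u v : Word} (huv : f ∈ memCyc u v) (hv : L v ^ 2 = 1) : L u = 1 ∨ L u = L v := by
    simp only [memCyc, Finset.mem_insert, Finset.mem_singleton] at huv
    rcases huv with rfl | rfl | rfl | rfl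
    · exact .inl e
    · exact .inr ((lift_eqn _ _ _).1 e)
    · rw [lift_eqn, ← hL, map_pow, hv] at e
      exact .inl e
    · rw [lift_eqn, ← hL, map_pow, pow_eq_self_of_sq_eq_one hv 1] at e
      exact .inr e
  rw [mem_elementaryAbelian8 hw] at hf
  rcases hf with ⟨i, j, hij, hf⟩ | ⟨σ, hf⟩ | ⟨σ, hf⟩ | ⟨i, rfl⟩ | ⟨i, j, hij, rfl⟩ |
    ⟨i, j, k, ⟨hij, hik⟩, rfl⟩ | ⟨i, j, k, ⟨hij, hik⟩, rfl⟩
  · have := hcyc hf (by rw [hw', hy])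
    rw [hw', hw'] at this
    exact this.elim (h1 i) (h2 i j hij)
  · have := hcyc hf (by rw [map_mul, hw', hw', hmul])
    rw [map_mul, hw', hw', hw'] at this
    exact this.elim (h1 _) (h3 _ _ _ (by simp) (by simp) (by simp))
  · have := hcyc hf (by rw [map_mul, hw', hw', hmul])
    rw [map_mul, map_mul, hw', hw', hw'] at this
    rcases this with h | h
    · rw [mul_eq_one_iff_eq_inv, hinv] at h
      exact h2 _ _ (by simp) h
    · rw [(hcomm _ _).eq, mul_right_inj] at h
      exact h2 _ _ (by simp) h
  · exact h1 i (by rw [← hw', e])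
  · rw [map_pow, map_mul, hw', hw', pow_eq_self_of_sq_eq_one (hmul _ _) 7, mul_eq_one_iff_eq_inv,
      hinv] at e
    exact h2 _ _ hij e
  · rw [map_pow, map_mul, map_mul, hw', hw', hw', pow_eq_self_of_sq_eq_one (hmul' _ _ _) 7] at e
    by_cases hjk : j = k
    · subst hjk
      rw [mul_assoc, ← sq, hy, mul_one] at e
      exact h1 _ e
    · rw [mul_assoc, mul_eq_one_iff_eq_inv, mul_inv_rev, hinv, hinv, (hcomm _ _).eq] at e
      exact h3 i j k hij.symm hik hjk e
  · have e' : (y i * y j * y k * y j) ^ 15 = 1 := by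
      rwa [map_pow, map_mul, map_mul, map_mul, hw', hw', hw'] at e
    rw [mul_assoc, (hcomm k j).eq, ← mul_assoc, mul_assoc (y i), ← sq, hy, mul_one,
      pow_eq_self_of_sq_eq_one (hmul _ _) 7, mul_eq_one_iff_eq_inv, hinv] at e'
    exact h2 _ _ hik e'

theorem isModel_of_satisfies {G : Type*} [Group G] (h1 : Satisfies G (omega 120))
    (h2 : Satisfies G exponents456) (h3 : Satisfies G fourCycles)
    (h4 : Satisfies G elementaryAbelian8) (h5 : Satisfies G order9) (h6 : Satisfies G abelian12)
    (h7 : Satisfies G dicyclic12) (h8 : Satisfies G order25) : IsModel G where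
  finite := (finite_and_card_le_of_satisfies_omega h1).1
  card_le := (finite_and_card_le_of_satisfies_omega h1).2
  exponents a := (exists_mem_exponents456 _).1 (h2 fun _ => a)
  fourCycles a b := (exists_mem_fourCycles _).1 (h3 fun n => if n = 1 then a else b)
  order9 a b := (exists_mem_order9 _).1 (h5 fun n => if n = 1 then a else b)
  abelian12 a b := (exists_mem_abelian12 _).1 (h6 fun n => if n = 1 then a else b)
  dicyclic12 a b := (exists_mem_dicyclic12 _).1 (h7 fun n => if n = 1 then a else b)
  order25 a b := (exists_mem_order25 _).1 (h8 fun n => if n = 1 then a else b)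
  elementaryAbelian a b c ha hb hc hab hac hbc := by
    have hinv {a : G} (ha : a ^ 2 = 1) : a⁻¹ = a := inv_eq_of_mul_eq_one_left (by rw [← sq, ha])
    have := elementaryAbelian_of_satisfies h4 (y := ![a, b, c])
      (by simp [Fin.forall_fin_succ, ha, hb, hc])
      (by simp [Fin.forall_fin_succ, hab, hac, hbc, hab.symm, hac.symm, hbc.symm])
    by_contra! hne
    obtain ⟨n1, n2, n3, n4, n5, n6, n7⟩ := hne
    have n8 : a ≠ b * c := fun h => n7 (by rw [h, hbc.eq, mul_assoc, ← sq, hb, mul_one])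
    have n9 : b ≠ a * c := fun h => n7 (by rw [h, ← mul_assoc, ← sq, ha, one_mul])
    simp [Fin.exists_fin_succ, n1, n2, n3, n4, n5, n6, n7, n8, n9, n4.symm, n5.symm, n6.symm,
      ← hab.eq, ← hac.eq, ← hbc.eq] at this

namespace IsModel

variable {G : Type*} [Group G]

/-- The conditions are universal, hence inherited. This lets the bounds proved for $p$-groups be
applied to subgroups of `G`. -/
theorem subgroup (h : IsModel G) (K : Subgroup G) : IsModel K where
  finite := have := h.finite; inferInstance
  card_le := have := h.finite; (Subgroup.card_le_card_group K).trans h.card_le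
  exponents a := by exact_mod_cast h.exponents a
  fourCycles a b := by exact_mod_cast h.fourCycles a b
  elementaryAbelian a b c ha hb hc hab hac hbc := by
    exact_mod_cast h.elementaryAbelian a b c (mod_cast ha) (mod_cast hb) (mod_cast hc)
      (congrArg Subtype.val hab.eq) (congrArg Subtype.val hac.eq) (congrArg Subtype.val hbc.eq)
  order9 a b := by exact_mod_cast h.order9 a b
  abelian12 a b := by exact_mod_cast h.abelian12 a b
  dicyclic12 a b := by exact_mod_cast h.dicyclic12 a b
  order25 a b := by exact_mod_cast h.order25 a b

/-! ### Subgroups of prime power order -/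

theorem orderOf_dvd (h : IsModel G) (a : G) : orderOf a ∣ 4 ∨ orderOf a ∣ 5 ∨ orderOf a ∣ 6 := by
  simpa only [orderOf_dvd_iff_pow_eq_one] using h.exponents a

theorem eq_one_of_pow_eq_one_of_coprime {a : G} {m n : ℕ} (hm : a ^ m = 1) (hn : a ^ n = 1)
    (h : m.Coprime n) : a = 1 := by
  rw [← orderOf_eq_one_iff]
  exact Nat.eq_one_of_dvd_coprimes h (orderOf_dvd_of_pow_eq_one hm) (orderOf_dvd_of_pow_eq_one hn)

theorem card_dvd_prime_of_forall_mem_zpowers {p : ℕ} (hp : p.Prime) (h : ∀ a : G, a ^ p = 1)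
    (hcyc : ∀ a b : G, a ≠ 1 → b ≠ 1 → b ∈ Subgroup.zpowers a) : Nat.card G ∣ p := by
  by_cases htriv : ∀ a : G, a = 1
  · have : Subsingleton G := ⟨fun a b => by rw [htriv a, htriv b]⟩
    rw [Nat.card_unique]
    exact one_dvd p
  push Not at htriv
  obtain ⟨a, ha⟩ := htriv
  have htop : Subgroup.zpowers a = ⊤ := by
    refine (Subgroup.eq_top_iff' _).2 fun b => ?_
    by_cases hb : b = 1
    · rw [hb]
      exact one_mem _
    · exact hcyc a b ha hb
  have : Fact p.Prime := ⟨hp⟩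
  rw [← Subgroup.card_top (G := G), ← htop, Nat.card_zpowers, orderOf_eq_prime (h a) ha]

theorem mem_zpowers_of_mul_pow_eq_one {a b : G} {n : ℕ} (h : a * b ^ n = 1) :
    a ∈ Subgroup.zpowers b := by
  rw [eq_inv_of_mul_eq_one_left h]
  exact inv_mem (pow_mem (Subgroup.mem_zpowers b) n)

/-- There is no elementary abelian subgroup of order 25. -/
theorem mem_zpowers_of_pow_five (h : IsModel G) {a b : G} (ha : a ^ 5 = 1)
    (hb : b ^ 5 = 1) (hb' : b ≠ 1) (hab : ∀ n : ℕ, (a * b ^ n) ^ 5 = 1) :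
    a ∈ Subgroup.zpowers b := by
  have key {c : G} (hc : c ^ 5 = 1) (hc' : c ^ 12 = 1) : c = 1 :=
    eq_one_of_pow_eq_one_of_coprime hc hc' (by norm_num)
  rcases h.order25 a b with h | h | h | h | h | h
  · rw [key ha h]
    exact one_mem _
  · exact absurd (key hb h) hb'
  · have h1 : a * b ^ 1 = 1 := key (hab 1) (by rwa [pow_one])
    exact mem_zpowers_of_mul_pow_eq_one h1
  · exact mem_zpowers_of_mul_pow_eq_one (key (hab 2) h)
  · exact mem_zpowers_of_mul_pow_eq_one (key (hab 3) h)
  · exact mem_zpowers_of_mul_pow_eq_one (key (hab 4) h)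

/-- The order of an element is a power of $p$ dividing 4, 5 or 6. The exponent $n$ used below is 2
for $p=2$, 1 for $p=3,5$, and 0 for all other primes. -/
theorem pow_eq_one_of_isPGroup (h : IsModel G) {p n : ℕ} (hG : IsPGroup p G)
    (hp : p.Prime) (hn : ¬p ^ (n + 1) ∣ 4 ∧ ¬p ^ (n + 1) ∣ 5 ∧ ¬p ^ (n + 1) ∣ 6) (a : G) :
    a ^ p ^ n = 1 := by
  have : Fact p.Prime := ⟨hp⟩
  obtain ⟨k, hk⟩ := IsPGroup.iff_orderOf.1 hG a
  rw [← orderOf_dvd_iff_pow_eq_one, hk]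
  refine pow_dvd_pow _ ?_
  by_contra! hnk
  have hdvd : p ^ (n + 1) ∣ orderOf a := hk ▸ pow_dvd_pow _ hnk
  rcases h.orderOf_dvd a with h | h | h
  · exact hn.1 (hdvd.trans h)
  · exact hn.2.1 (hdvd.trans h)
  · exact hn.2.2 (hdvd.trans h)

theorem card_dvd_five (h : IsModel G) (hG : IsPGroup 5 G) : Nat.card G ∣ 5 := by
  have h5 : ∀ a : G, a ^ 5 = 1 := fun a => by
    simpa using h.pow_eq_one_of_isPGroup (n := 1) hG (by norm_num) (by norm_num) a
  exact card_dvd_prime_of_forall_mem_zpowers (by norm_num) h5 fun a b ha _ =>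
    h.mem_zpowers_of_pow_five (h5 b) (h5 a) ha fun _ => h5 _

/-- The exponents 20, 10 and 2 in `order9` are prime to 3, and $a^2=a^{-1}$ here, so for nontrivial
elements every disjunct puts one of them in the subgroup generated by the other. -/
theorem card_dvd_three (h : IsModel G) (hG : IsPGroup 3 G) : Nat.card G ∣ 3 := by
  have h3 : ∀ a : G, a ^ 3 = 1 := fun a => by
    simpa using h.pow_eq_one_of_isPGroup (n := 1) hG (by norm_num) (by norm_num) a
  have hsq (a : G) : a ^ 2 = a⁻¹ := eq_inv_of_mul_eq_one_left (by rw [← pow_succ, h3])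
  refine card_dvd_prime_of_forall_mem_zpowers (by norm_num) h3 fun a b ha hb => ?_
  rcases h.order9 b a with h | h | h | h | h
  · exact absurd (eq_one_of_pow_eq_one_of_coprime (h3 b) h (by norm_num)) hb
  · exact absurd (eq_one_of_pow_eq_one_of_coprime (h3 a) h (by norm_num)) ha
  · rw [hsq, hsq, inv_inj] at h
    rw [h]
    exact Subgroup.mem_zpowers a
  · have h := eq_one_of_pow_eq_one_of_coprime (h3 _) h (by norm_num)
    rw [hsq, mul_eq_one_iff_inv_eq, inv_inv] at h
    rw [h]
    exact pow_mem (Subgroup.mem_zpowers a) 2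
  · have h := eq_one_of_pow_eq_one_of_coprime (h3 _) h (by norm_num)
    rw [pow_succ, h3, one_mul] at h
    exact mem_zpowers_of_mul_pow_eq_one h

/-- In exponent 4 the 30th power is the square and only 1 has trivial 15th power, so `fourCycles`
yields $ab^n=1$ for some $n\le 3$. Thus there is at most one cyclic subgroup of order 4. -/
theorem mem_zpowers_of_order_four (h : IsModel G) (hG : ∀ a : G, a ^ 4 = 1) {a b : G}
    (ha : a ^ 2 ≠ 1) (hb : b ^ 2 ≠ 1) : a ∈ Subgroup.zpowers b := by
  have hpow {a : G} : a ^ 30 = a ^ 2 := by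
    rw [show 30 = 4 * 7 + 2 by norm_num, pow_add, pow_mul, hG, one_pow, one_mul]
  have key {c : G} (hc : c ^ 15 = 1) : c = 1 :=
    eq_one_of_pow_eq_one_of_coprime (hG c) hc (by norm_num)
  rcases h.fourCycles a b with h | h | h | h | h
  · exact absurd (hpow ▸ h) ha
  · exact absurd (hpow ▸ h) hb
  · have h1 : a * b ^ 1 = 1 := by rw [pow_one, key h]
    exact mem_zpowers_of_mul_pow_eq_one h1
  · exact mem_zpowers_of_mul_pow_eq_one (key h)
  · exact mem_zpowers_of_mul_pow_eq_one (key h)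

/-- Elements outside a cyclic subgroup of order four are involutions that invert it. -/
theorem sq_eq_one_and_conj_eq_inv (h : IsModel G) (hG : ∀ a : G, a ^ 4 = 1) {b c : G}
    (hc : c ^ 2 ≠ 1) (hb : b ∉ Subgroup.zpowers c) :
    b ^ 2 = 1 ∧ b * c * b⁻¹ = c⁻¹ := by
  have key {b : G} (hb : b ∉ Subgroup.zpowers c) : b ^ 2 = 1 :=
    of_not_not fun hb' => hb (h.mem_zpowers_of_order_four hG hb' hc)
  refine ⟨key hb, ?_⟩
  -- The element $bc$ also lies outside $\langle c\rangle$; for involutions $b$ and $bc$ this says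
  -- that $b$ inverts $c$.
  have hbc : (b * c) ^ 2 = 1 :=
    key fun h => hb ((Subgroup.mul_mem_cancel_right _ (Subgroup.mem_zpowers c)).1 h)
  have hinv : b⁻¹ = b := inv_eq_of_mul_eq_one_left (by rw [← sq, key hb])
  rw [hinv, eq_inv_iff_mul_eq_one, ← hbc, sq]
  group

theorem orderOf_eq_four (hG : ∀ a : G, a ^ 4 = 1) {c : G} (hc : c ^ 2 ≠ 1) : orderOf c = 4 :=
  orderOf_eq_prime_pow (p := 2) (n := 1) (by simpa using hc) (by simpa using hG c)

/-- Every element outside $\langle c\rangle$ inverts $c$, so a product of two such elements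
centralizes $c$. As $c\ne c^{-1}$, the product lies in $\langle c\rangle$, whose index is therefore
at most 2. -/
theorem card_dvd_eight_of_sq_ne_one (h : IsModel G) (hG : ∀ a : G, a ^ 4 = 1) {c : G}
    (hc : c ^ 2 ≠ 1) : Nat.card G ∣ 8 := by
  have hcard : Nat.card (Subgroup.zpowers c) = 4 := by
    rw [Nat.card_zpowers, orderOf_eq_four hG hc]
  by_cases htop : ∀ b, b ∈ Subgroup.zpowers c
  · rw [(Subgroup.eq_top_iff' _).2 htop, Subgroup.card_top] at hcard
    rw [hcard]
    norm_num
  push Not at htop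
  obtain ⟨b, hb⟩ := htop
  have hidx : (Subgroup.zpowers c).index = 2 := by
    refine Subgroup.index_eq_two_iff.2 ⟨b, fun a => ?_⟩
    by_cases ha : a ∈ Subgroup.zpowers c
    · exact .inr ⟨ha, fun hab => hb ((Subgroup.mul_mem_cancel_left _ ha).1 hab)⟩
    · refine .inl ⟨?_, ha⟩
      by_contra hab
      have h1 := (h.sq_eq_one_and_conj_eq_inv hG hc ha).2
      have h2 := (h.sq_eq_one_and_conj_eq_inv hG hc hb).2
      have h3 := (h.sq_eq_one_and_conj_eq_inv hG hc hab).2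
      have h4 : a * b * c * (a * b)⁻¹ = (a * c * a⁻¹)⁻¹ := by
        rw [conj_inv, ← h2]
        group
      rw [h4, h1, inv_inv, eq_inv_iff_mul_eq_one, ← sq] at h3
      exact hc h3
  rw [← Subgroup.card_mul_index (Subgroup.zpowers c), hcard, hidx]

theorem card_le_four_of_sq_eq_one (h : IsModel G) (hsq : ∀ a : G, a ^ 2 = 1) : Nat.card G ≤ 4 := by
  have hinv (a : G) : a⁻¹ = a := inv_eq_of_mul_eq_one_left (by rw [← sq, hsq])
  have hcomm (a b : G) : Commute a b := by
    rw [Commute, SemiconjBy, ← hinv (a * b), mul_inv_rev, hinv, hinv]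
  obtain ⟨a, b, hab⟩ : ∃ a b : G, ∀ c, c = 1 ∨ c = a ∨ c = b ∨ c = a * b := by
    by_contra! hne
    -- The degenerate pairs $(1,1)$ and $(a,a)$ supply $a\ne1$ and then $b\notin\{1,a\}$; the pair
    -- $(a,b)$ supplies a third independent element.
    obtain ⟨a, ha, -⟩ := hne 1 1
    obtain ⟨b, hb, hba, -⟩ := hne a a
    obtain ⟨c, hc, hca, hcb, hcab⟩ := hne a b
    rcases h.elementaryAbelian a b c (hsq a) (hsq b) (hsq c) (hcomm _ _) (hcomm _ _) (hcomm _ _)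
      with h | h | h | h | h | h | h
    · exact ha h
    · exact hb h
    · exact hc h
    · exact hba h.symm
    · exact hca h.symm
    · exact hcb h.symm
    · exact hcab h
  have := h.finite
  have := Fintype.ofFinite G
  classical
  rw [Nat.card_eq_fintype_card, ← Finset.card_univ]
  have hsub : (Finset.univ : Finset G) ⊆ {1, a, b, a * b} := fun c _ => by simpa using hab c
  exact (Finset.card_le_card hsub).trans Finset.card_le_four

theorem pow_four_eq_one (h : IsModel G) (hG : IsPGroup 2 G) (a : G) : a ^ 4 = 1 := by
  simpa using h.pow_eq_one_of_isPGroup (n := 2) hG (by norm_num) (by norm_num) a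

theorem card_dvd_eight (h : IsModel G) (hG : IsPGroup 2 G) : Nat.card G ∣ 8 := by
  by_cases hsq : ∀ a : G, a ^ 2 = 1
  · have := h.finite
    have hle := h.card_le_four_of_sq_eq_one hsq
    obtain ⟨k, hk⟩ := IsPGroup.iff_card.1 hG
    rw [hk] at hle ⊢
    refine pow_dvd_pow 2 (n := 3) ?_
    by_contra! hk
    have := Nat.pow_le_pow_right (n := 2) (by norm_num) hk.le
    omega
  · push Not at hsq
    obtain ⟨c, hc⟩ := hsq
    exact h.card_dvd_eight_of_sq_ne_one (h.pow_four_eq_one hG) hc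

/-- Each prime power dividing the order is the order of a subgroup, which the bounds for $p$-groups
make a divisor of 8, 3 or 5, or trivial when $p>5$. -/
theorem card_dvd (h : IsModel G) : Nat.card G ∣ 120 := by
  have := h.finite
  rw [Nat.dvd_iff_prime_pow_dvd_dvd]
  intro p k hp hpk
  have : Fact p.Prime := ⟨hp⟩
  obtain ⟨K, hK⟩ := Sylow.exists_subgroup_card_pow_prime p hpk
  have hKp : IsPGroup p K := IsPGroup.of_card hK
  rw [← hK]
  by_cases h2 : p = 2
  · subst h2
    exact ((h.subgroup K).card_dvd_eight hKp).trans (by norm_num)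
  by_cases h3 : p = 3
  · subst h3
    exact ((h.subgroup K).card_dvd_three hKp).trans (by norm_num)
  by_cases h5 : p = 5
  · subst h5
    exact ((h.subgroup K).card_dvd_five hKp).trans (by norm_num)
  have hndvd : ¬p ∣ 4 ∧ ¬p ∣ 5 ∧ ¬p ∣ 6 := by
    have e2 := (Nat.prime_dvd_prime_iff_eq hp Nat.prime_two).not.2 h2
    have e3 := (Nat.prime_dvd_prime_iff_eq hp Nat.prime_three).not.2 h3
    have e5 := (Nat.prime_dvd_prime_iff_eq hp Nat.prime_five).not.2 h5
    refine ⟨?_, e5, ?_⟩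
    · rw [show 4 = 2 * 2 by norm_num, hp.dvd_mul, or_self]
      exact e2
    · rw [show 6 = 2 * 3 by norm_num, hp.dvd_mul, not_or]
      exact ⟨e2, e3⟩
  have : Subsingleton K := ⟨fun a b => by
    have key (c : K) : c = 1 := by
      simpa using (h.subgroup K).pow_eq_one_of_isPGroup (n := 0) hKp hp (by simpa using hndvd) c
    rw [key a, key b]⟩
  rw [Nat.card_unique]
  exact one_dvd _

end IsModel

/-! ### Embeddings into `S₅` -/

/-- `G` is isomorphic to a subgroup of `S₅`. -/
def Embeds (G : Type*) [Group G] : Prop :=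
  ∃ f : G →* Perm (Fin 5), Function.Injective f

theorem Embeds.inDVar {G : Type*} [Group G] (h : Embeds G) : InDVar (Perm (Fin 5)) G := by
  obtain ⟨f, hf⟩ := h
  intro δ hδ a
  obtain ⟨w, hw, e⟩ := hδ fun i => f (a i)
  refine ⟨w, hw, hf ?_⟩
  have key : FreeGroup.lift (fun i => f (a i)) = f.comp (FreeGroup.lift a) := by
    ext; simp
  rw [key] at e
  rw [map_one]
  exact e

theorem Embeds.of_injective {G H : Type*} [Group G] [Group H] (f : G →* H)
    (hf : Function.Injective f) (h : Embeds H) : Embeds G :=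
  let ⟨g, hg⟩ := h
  ⟨g.comp f, hg.comp hf⟩

theorem embeds_perm {X : Type*} [Finite X] (hX : Nat.card X ≤ 5) : Embeds (Perm X) := by
  have := Fintype.ofFinite X
  obtain ⟨ι⟩ : Nonempty (X ↪ Fin 5) :=
    Function.Embedding.nonempty_of_card_le (by simpa [Nat.card_eq_fintype_card] using hX)
  exact ⟨Perm.viaEmbeddingHom ι, Perm.viaEmbeddingHom_injective ι⟩

section Cosets

variable {G : Type*} [Group G]

theorem embeds_of_card_le [Finite G] (h : Nat.card G ≤ 5) : Embeds G :=
  (embeds_perm h).of_injective (MulAction.toPermHom G G) MulAction.toPerm_injective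

theorem toPermHom_injective_of_normalCore_eq_bot {K : Subgroup G} (hK : K.normalCore = ⊥) :
    Function.Injective (MulAction.toPermHom G (G ⧸ K)) := by
  rw [← MonoidHom.ker_eq_bot_iff, ← Subgroup.normalCore_eq_ker, hK]

theorem embeds_of_index_le [Finite G] {K : Subgroup G} (hK : K.normalCore = ⊥)
    (hidx : K.index ≤ 5) : Embeds G :=
  (embeds_perm hidx).of_injective _ (toPermHom_injective_of_normalCore_eq_bot hK)

/-- The kernel of the action on the disjoint union of `G ⧸ K` and `G ⧸ L` is the intersection of the
two cores. Using `L` in place of its core gives a sufficient condition that is easier to verify. -/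
theorem embeds_of_index_add_index_le [Finite G] {K L : Subgroup G}
    (hKL : K.normalCore ⊓ L = ⊥) (hidx : K.index + L.index ≤ 5) : Embeds G := by
  have hX : Nat.card ((G ⧸ K) ⊕ (G ⧸ L)) ≤ 5 := by
    rw [Nat.card_sum]
    exact hidx
  refine (embeds_perm hX).of_injective ((Perm.sumCongrHom _ _).comp
    ((MulAction.toPermHom G (G ⧸ K)).prod (MulAction.toPermHom G (G ⧸ L)))) ?_
  rw [MonoidHom.coe_comp]
  refine Perm.sumCongrHom_injective.comp ?_
  rw [← MonoidHom.ker_eq_bot_iff, MonoidHom.ker_prod, ← Subgroup.normalCore_eq_ker,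
    ← Subgroup.normalCore_eq_ker, eq_bot_iff, ← hKL]
  exact inf_le_inf_left _ L.normalCore_le

/-- A subgroup of index six with trivial core acts faithfully on the five nontrivial cosets. -/
theorem embeds_subgroup_of_index_eq_six [Finite G] {K : Subgroup G} (hK : K.normalCore = ⊥)
    (hidx : K.index = 6) : Embeds K := by
  let X := {q : G ⧸ K // q ≠ ((1 : G) : G ⧸ K)}
  have hfix (k : K) : (k : G) • ((1 : G) : G ⧸ K) = ((1 : G) : G ⧸ K) := by
    rw [MulAction.Quotient.smul_mk, smul_eq_mul, mul_one, QuotientGroup.eq, mul_one]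
    exact inv_mem k.2
  let act : MulAction K X :=
    { smul := fun k q => ⟨(k : G) • q.1, fun h =>
        q.2 (MulAction.injective (k : G) (h.trans (hfix k).symm))⟩
      one_smul := fun q => Subtype.ext (one_smul G q.1)
      mul_smul := fun k l q => Subtype.ext (mul_smul (k : G) (l : G) q.1) }
  have hX : Nat.card X ≤ 5 := by
    classical
    have := Fintype.ofFinite (G ⧸ K)
    have h6 : Fintype.card (G ⧸ K) = 6 := by rw [← Nat.card_eq_fintype_card]; exact hidx
    rw [Nat.card_eq_fintype_card, Fintype.card_subtype_compl, h6]
    simp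
  refine (embeds_perm hX).of_injective (MulAction.toPermHom K X) ?_
  rw [injective_iff_map_eq_one]
  intro k hk
  -- An element of `K` fixing the other five cosets also fixes `K` itself, so it acts trivially on
  -- all six.
  refine Subtype.ext (toPermHom_injective_of_normalCore_eq_bot hK ?_)
  rw [OneMemClass.coe_one, map_one]
  ext q
  by_cases hq : q = ((1 : G) : G ⧸ K)
  · rw [hq]
    exact hfix k
  · exact congrArg Subtype.val (DFunLike.congr_fun hk (⟨q, hq⟩ : X))

/-! ### Sylow subgroups of prime order -/

variable [Finite G] {p : ℕ} [Fact p.Prime]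

/-- As $P$ has prime order, a nontrivial intersection would put $P$, and with it every conjugate of
$P$, in the core. But a $p$-subgroup normalizing $P$ lies in $P$, so $P$ would be the only Sylow
subgroup. -/
theorem normalCore_normalizer_inf_eq_bot {P : Sylow p G} (hP : Nat.card P = p)
    (hidx : (Subgroup.normalizer (P : Set G)).index ≠ 1) :
    (Subgroup.normalizer (P : Set G)).normalCore ⊓ P = ⊥ := by
  set N := Subgroup.normalizer (P : Set G)
  by_contra hne
  have hPN : (P : Subgroup G) ≤ N.normalCore := by
    have hdvd : Nat.card (N.normalCore ⊓ P : Subgroup G) ∣ p :=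
      (Subgroup.card_dvd_of_le inf_le_right).trans hP.dvd
    rcases (Nat.dvd_prime Fact.out).1 hdvd with h | h
    · exact absurd (Subgroup.card_eq_one.1 h) hne
    · have := Subgroup.eq_of_le_of_card_ge (inf_le_right : N.normalCore ⊓ P ≤ P) (by rw [h, hP])
      exact inf_eq_right.1 this
  have hsub : ∀ Q : Sylow p G, Q = P := by
    intro Q
    obtain ⟨g, rfl⟩ := MulAction.exists_smul_eq G P Q
    have hle : ((g • P : Sylow p G) : Subgroup G) ≤ N := by
      refine le_trans ?_ N.normalCore_le
      intro y hy
      rw [Sylow.coe_subgroup_smul, Subgroup.mem_pointwise_smul_iff_inv_smul_mem] at hy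
      have := N.normalCore_normal.conj_mem _ (hPN hy) g
      simpa [MulAut.smul_def, mul_assoc] using this
    have h1 := (g • P).2.inf_normalizer_sylow P
    rw [inf_eq_left.2 hle] at h1
    have h2 := (g • P).3 P.2 (h1 ▸ inf_le_right)
    exact Sylow.ext h2.symm
  have : Subsingleton (Sylow p G) := ⟨fun Q R => by rw [hsub Q, hsub R]⟩
  rw [← Sylow.card_eq_index_normalizer] at hidx
  exact hidx (Nat.card_unique)

/-- The commutator of $m$ and $a$ lies both in the core and in $P$, and these meet trivially. -/
theorem commute_of_mem_normalCore_normalizer {P : Sylow p G} (hP : Nat.card P = p)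
    (hidx : (Subgroup.normalizer (P : Set G)).index ≠ 1) {m a : G}
    (hm : m ∈ (Subgroup.normalizer (P : Set G)).normalCore) (ha : a ∈ P) : Commute m a := by
  have hbot := normalCore_normalizer_inf_eq_bot hP hidx
  set N := Subgroup.normalizer (P : Set G)
  have h1 : m * a * m⁻¹ * a⁻¹ ∈ N.normalCore ⊓ P := by
    refine Subgroup.mem_inf.2 ⟨?_, ?_⟩
    · have := mul_mem hm (N.normalCore_normal.conj_mem _ (inv_mem hm) a)
      simpa only [mul_assoc] using this
    · have hmN : m ∈ N := N.normalCore_le hm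
      exact mul_mem ((Subgroup.mem_normalizer_iff.1 hmN a).1 ha) (inv_mem ha)
  rw [hbot, Subgroup.mem_bot, mul_inv_eq_one, mul_inv_eq_iff_eq_mul] at h1
  exact h1

end Cosets

namespace IsModel

variable {G : Type*} [Group G]

/-! ### Groups of order divisible by five -/

/-- Elements of order five are self-centralizing. -/
theorem mem_zpowers_of_commute (h : IsModel G) {a b : G} (hb : b ^ 5 = 1) (hb' : b ≠ 1)
    (hab : Commute a b) : a ∈ Subgroup.zpowers b := by
  have hmul (n : ℕ) : (a * b) ^ n = a ^ n * b ^ n := hab.mul_pow n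
  have hpow {n m : ℕ} (h : a ^ n * b ^ n = 1) (ha : a ^ (n * m) = 1) : b ^ (n * m) = 1 := by
    have := congrArg (· ^ m) h
    simpa only [one_pow, (hab.pow_pow n n).mul_pow, ← pow_mul, ha, one_mul] using this
  have hone {n : ℕ} (hn : n.Coprime 5) (h : b ^ n = 1) : a ∈ Subgroup.zpowers b :=
    absurd (eq_one_of_pow_eq_one_of_coprime h hb hn) hb'
  have hone' {n : ℕ} (hn : n.Coprime 5) (h : a ^ n = 1) (h' : (a * b) ^ 5 = 1) :
      a ∈ Subgroup.zpowers b := by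
    rw [hmul, hb, mul_one] at h'
    rw [eq_one_of_pow_eq_one_of_coprime h h' hn]
    exact one_mem _
  -- If $a^5=1$, the absence of $C_5\times C_5$ applies. If $a^{12}=1$, the order of $a$ is prime to
  -- 5 and $ab$ has order five times as large, which `exponents` allows only for $a=1$.
  have key : a ^ 5 = 1 ∨ a ^ 12 = 1 := by
    rcases h.exponents a with h | h | h
    · exact .inr (by rw [show 12 = 4 * 3 by norm_num, pow_mul, h, one_pow])
    · exact .inl h
    · exact .inr (by rw [show 12 = 6 * 2 by norm_num, pow_mul, h, one_pow])
  rcases key with ha | ha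
  · refine h.mem_zpowers_of_pow_five ha hb hb' fun n => ?_
    rw [(hab.pow_right n).mul_pow, ha, one_mul, ← pow_mul, mul_comm, pow_mul, hb, one_pow]
  · rcases h.exponents (a * b) with h | h | h
    · rw [hmul] at h
      exact hone (by norm_num) (hpow (m := 3) h ha)
    · exact hone' (by norm_num) ha h
    · rw [hmul] at h
      exact hone (by norm_num) (hpow (m := 2) h ha)

theorem card_sylow_five (h : IsModel G) (h5 : 5 ∣ Nat.card G) (P : Sylow 5 G) :
    Nat.card P = 5 := by
  have := h.finite
  have : Fact (Nat.Prime 5) := ⟨by norm_num⟩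
  exact Nat.dvd_antisymm ((h.subgroup P).card_dvd_five P.2) (P.dvd_card_of_dvd_card h5)

theorem card_sylow_three (h : IsModel G) (h3 : 3 ∣ Nat.card G) (P : Sylow 3 G) :
    Nat.card P = 3 := by
  have := h.finite
  exact Nat.dvd_antisymm ((h.subgroup P).card_dvd_three P.2) (P.dvd_card_of_dvd_card h3)

theorem exists_ne_one_pow_eq_one {p : ℕ} (hp : 1 < p) {P : Subgroup G} (hP : Nat.card P = p) :
    ∃ a ∈ P, a ≠ 1 ∧ a ^ p = 1 := by
  have : Finite P := Nat.finite_of_card_ne_zero (by omega)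
  have : Nontrivial P := Finite.one_lt_card_iff_nontrivial.1 (hP ▸ hp)
  obtain ⟨a, ha⟩ := exists_ne (1 : P)
  refine ⟨a, a.2, by simpa using ha, ?_⟩
  have := pow_card_eq_one' (x := a)
  rw [hP] at this
  exact_mod_cast this

theorem mem_of_forall_commute (h : IsModel G) {P : Subgroup G} (hP : Nat.card P = 5) {g : G}
    (hg : ∀ a ∈ P, Commute g a) : g ∈ P := by
  obtain ⟨a, haP, ha, ha'⟩ := exists_ne_one_pow_eq_one (by norm_num) hP
  exact (Subgroup.zpowers_le.2 haP) (h.mem_zpowers_of_commute ha' ha (hg a haP))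

/-- The centralizer of $P$ lies in $P$, giving the factor 5, and the quotient by it embeds in the
automorphism group of $C_5$, of order 4. -/
theorem card_normalizer_dvd (h : IsModel G) {P : Subgroup G} (hP : Nat.card P = 5) :
    Nat.card (Subgroup.normalizer (P : Set G)) ∣ 20 := by
  have := h.finite
  have : Fact (Nat.Prime 5) := ⟨by norm_num⟩
  have : IsCyclic P := isCyclic_of_prime_card hP
  rw [← Subgroup.card_mul_index P.normalizerMonoidHom.ker, show 20 = 5 * 4 by norm_num]
  refine mul_dvd_mul ?_ ?_
  · have hle : P.normalizerMonoidHom.ker ≤ P.subgroupOf (Subgroup.normalizer (P : Set G)) := by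
      rw [Subgroup.normalizerMonoidHom_ker]
      intro g hg
      refine h.mem_of_forall_commute hP fun a ha => ?_
      exact (Subgroup.mem_centralizer_iff.1 hg a ha).symm
    refine (Subgroup.card_dvd_of_le hle).trans ?_
    rw [Nat.card_congr (Subgroup.subgroupOfEquivOfLe Subgroup.le_normalizer).toEquiv, hP]
  · rw [Subgroup.index_ker]
    refine (Subgroup.card_subgroup_dvd_card _).trans ?_
    rw [IsCyclic.card_mulAut, hP]
    decide

/-- The index counts the Sylow 5-subgroups: it is 1 modulo 5 and divides 24. -/
theorem index_normalizer_eq (h : IsModel G) {P : Sylow 5 G} (hP : Nat.card P = 5) :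
    (Subgroup.normalizer (P : Set G)).index = 1 ∧ Nat.card G ∣ 20 ∨
    (Subgroup.normalizer (P : Set G)).index = 6 ∧
      (Nat.card G = 30 ∨ Nat.card G = 60 ∨ Nat.card G = 120) := by
  have := h.finite
  have : Fact (Nat.Prime 5) := ⟨by norm_num⟩
  have hmod := card_sylow_modEq_one 5 G
  rw [P.card_eq_index_normalizer] at hmod
  have hN := h.card_normalizer_dvd hP
  have h5 : 5 ∣ Nat.card (Subgroup.normalizer (P : Set G)) :=
    hP.symm.dvd.trans (Subgroup.card_dvd_of_le Subgroup.le_normalizer)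
  have hmul := Subgroup.card_mul_index (Subgroup.normalizer (P : Set G))
  have hG := h.card_dvd
  change Nat.card (Subgroup.normalizer (P : Set G)) ∣ 20 at hN
  generalize Nat.card (Subgroup.normalizer (P : Set G)) = m at *
  generalize (Subgroup.normalizer (P : Set G)).index = n at *
  rw [← hmul] at hG ⊢
  obtain ⟨k, rfl⟩ := h5
  have hk : k ∣ 4 := Nat.dvd_of_mul_dvd_mul_left (k := 5) (by norm_num) hN
  have hk' : k ≤ 4 := Nat.le_of_dvd (by norm_num) hk
  have hn : n ∣ 24 := by
    refine Nat.dvd_of_mul_dvd_mul_left (k := 5) (by norm_num) (dvd_trans ⟨k, ?_⟩ hG)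
    ring
  have hn' : n ≤ 24 := Nat.le_of_dvd (by norm_num) hn
  have hn1 : n = 1 ∨ n = 6 := by
    rw [Nat.ModEq] at hmod
    interval_cases n <;> omega
  rcases hn1 with rfl | rfl
  · left
    simpa using hN
  · right
    interval_cases k <;> omega

theorem card_ne_fifteen (h : IsModel G) : Nat.card G ≠ 15 := by
  intro hG
  have := h.finite
  obtain ⟨P⟩ := (inferInstance : Nonempty (Sylow 5 G))
  rcases h.index_normalizer_eq (h.card_sylow_five (by rw [hG]; norm_num) P) with h | h
  · rw [hG] at h
    omega
  · omega

/-- A Sylow 2-subgroup would be cyclic of order 2, and 2 is the smallest prime factor of 30, so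
transfer yields a complement of order 15, which is already excluded. -/
theorem card_ne_thirty (h : IsModel G) : Nat.card G ≠ 30 := by
  intro hG
  have := h.finite
  obtain ⟨Q⟩ := (inferInstance : Nonempty (Sylow 2 G))
  have hmul := Subgroup.card_mul_index (Q : Subgroup G)
  have hdvd : Nat.card Q ∣ 8 := (h.subgroup Q).card_dvd_eight Q.2
  have h2 : 2 ∣ Nat.card Q := Q.dvd_card_of_dvd_card (by rw [hG]; norm_num)
  have hQ : Nat.card Q = 2 := by
    have hle := Nat.le_of_dvd (by norm_num) hdvd
    rw [hG] at hmul
    generalize Nat.card Q = m at *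
    interval_cases m <;> omega
  have hcyc : IsCyclic Q := isCyclic_of_prime_card hQ
  have hcompl := IsCyclic.isComplement' (p := 2) (by rw [hG]; norm_num) hcyc
  have hcard := hcompl.card_mul_card
  rw [hQ] at hcard
  exact (h.subgroup _).card_ne_fifteen
    (Nat.eq_of_mul_eq_mul_right (by norm_num : 0 < 2) (hcard.trans hG))

/-- The core of a Sylow 2-subgroup $Q$ and the normal subgroup $P$ are disjoint, so they commute;
self-centralization puts the core in $P$, hence it is trivial. The index of $Q$ is odd and divides
20, so it divides 5. -/
theorem embeds_of_sylow_five_normal (h : IsModel G) {P : Sylow 5 G} (hP : Nat.card P = 5)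
    (hidx : (Subgroup.normalizer (P : Set G)).index = 1) (hG : Nat.card G ∣ 20) : Embeds G := by
  have := h.finite
  have : Fact (Nat.Prime 5) := ⟨by norm_num⟩
  have hnormal : (P : Subgroup G).Normal :=
    Subgroup.normalizer_eq_top_iff.1 (Subgroup.index_eq_one.1 hidx)
  obtain ⟨Q⟩ := (inferInstance : Nonempty (Sylow 2 G))
  have hdisj : Disjoint (Q : Subgroup G).normalCore P :=
    (IsPGroup.disjoint_of_ne 2 5 (by norm_num) _ _ Q.2 P.2).mono_left (Subgroup.normalCore_le _)
  have hcore : (Q : Subgroup G).normalCore = ⊥ := by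
    refine (Subgroup.eq_bot_iff_forall _).2 fun m hm => ?_
    have hmP : m ∈ (P : Subgroup G) := h.mem_of_forall_commute hP fun a ha =>
      Subgroup.commute_of_normal_of_disjoint _ _ (Subgroup.normalCore_normal _) hnormal hdisj
        m a hm ha
    exact Subgroup.disjoint_def.1 hdisj hm hmP
  refine embeds_of_index_le hcore (Nat.le_of_dvd (by norm_num) ?_)
  have hodd : Nat.Coprime (Q : Subgroup G).index 4 :=
    Nat.Coprime.pow_right 2 (Nat.coprime_comm.1
      ((Nat.Prime.coprime_iff_not_dvd Nat.prime_two).2 Q.not_dvd_index))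
  exact hodd.dvd_of_dvd_mul_left (((Q : Subgroup G).index_dvd_card).trans hG)

/-- The core centralizes $P$, so it lies in $P$, which it meets trivially. This makes the action on
the six cosets of the normalizer faithful. -/
theorem normalCore_normalizer_eq_bot (h : IsModel G) {P : Sylow 5 G} (hP : Nat.card P = 5)
    (hidx : (Subgroup.normalizer (P : Set G)).index ≠ 1) :
    (Subgroup.normalizer (P : Set G)).normalCore = ⊥ := by
  have := h.finite
  have : Fact (Nat.Prime 5) := ⟨by norm_num⟩
  refine (Subgroup.eq_bot_iff_forall _).2 fun m hm => ?_
  have hmP : m ∈ (P : Subgroup G) := h.mem_of_forall_commute hP fun a ha =>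
    commute_of_mem_normalCore_normalizer hP hidx hm ha
  have : m ∈ (Subgroup.normalizer (P : Set G)).normalCore ⊓ P := Subgroup.mem_inf.2 ⟨hm, hmP⟩
  rwa [normalCore_normalizer_inf_eq_bot hP hidx, Subgroup.mem_bot] at this

/-- The image has index 6 in $S_6$. A nontrivial core would contain $A_6$, which has order 360, so
the action on the other five cosets is faithful. -/
theorem embeds_of_card_eq_one_hundred_twenty {X : Type*} [Finite X] (hX : Nat.card X = 6)
    (f : G →* Perm X) (hf : Function.Injective f) (hG : Nat.card G = 120) : Embeds G := by
  classical
  have := Fintype.ofFinite X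
  have hcard : Nat.card f.range = 120 := by
    rw [← hG, ← Nat.card_congr (MonoidHom.ofInjective hf).toEquiv]
  have hperm : Nat.card (Perm X) = 720 := by
    rw [Nat.card_perm, hX]
    rfl
  have hidx : f.range.index = 6 := by
    have := Subgroup.card_mul_index f.range
    rw [hcard, hperm] at this
    omega
  have hcore : f.range.normalCore = ⊥ := by
    by_contra hne
    have hle := Perm.alternatingGroup_le_of_normal (by omega)
      ((Subgroup.nontrivial_iff_ne_bot _).2 hne)
    have halt : Nat.card (alternatingGroup X) ≤ Nat.card f.range :=
      Subgroup.card_le_of_le (hle.trans (Subgroup.normalCore_le _))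
    have : Nontrivial X := Finite.one_lt_card_iff_nontrivial.1 (by omega)
    have := two_mul_nat_card_alternatingGroup (α := X)
    omega
  exact (embeds_subgroup_of_index_eq_six hcore hidx).of_injective f.rangeRestrict
    (f.rangeRestrict_injective_iff.2 hf)

/-- The image lies in $A_6$, since an odd element would make the kernel of the sign a subgroup of
order 30. There it has index 6, and its core is trivial because $A_6$ is simple. -/
theorem embeds_of_card_eq_sixty (h : IsModel G) {X : Type*} [Finite X] (hX : Nat.card X = 6)
    (f : G →* Perm X) (hf : Function.Injective f) (hG : Nat.card G = 60) : Embeds G := by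
  classical
  have := h.finite
  have := Fintype.ofFinite X
  have : Nontrivial X := Finite.one_lt_card_iff_nontrivial.1 (by omega)
  have heven (g : G) : f g ∈ alternatingGroup X := by
    rw [Perm.mem_alternatingGroup]
    by_contra hg
    have hrange : Nat.card (Perm.sign.comp f).range = 2 := by
      have h2 : Nat.card ℤˣ = 2 := by simp
      have hdvd : Nat.card (Perm.sign.comp f).range ∣ 2 :=
        h2 ▸ Subgroup.card_subgroup_dvd_card _
      refine ((Nat.dvd_prime Nat.prime_two).1 hdvd).resolve_left fun h1 => hg ?_
      have : Perm.sign (f g) ∈ (Perm.sign.comp f).range := ⟨g, rfl⟩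
      rwa [Subgroup.card_eq_one.1 h1, Subgroup.mem_bot] at this
    have hmul := Subgroup.card_mul_index (Perm.sign.comp f).ker
    rw [Subgroup.index_ker, hrange, hG] at hmul
    exact (h.subgroup (Perm.sign.comp f).ker).card_ne_thirty (by omega)
  let f' : G →* alternatingGroup X := f.codRestrict _ heven
  have hf' : Function.Injective f' := fun a b hab => hf (congrArg Subtype.val hab)
  have hcard : Nat.card f'.range = 60 := by
    rw [← hG, ← Nat.card_congr (MonoidHom.ofInjective hf').toEquiv]
  have halt : 2 * Nat.card (alternatingGroup X) = 720 := by
    rw [two_mul_nat_card_alternatingGroup, Nat.card_perm, hX]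
    rfl
  have hidx : f'.range.index = 6 := by
    have := Subgroup.card_mul_index f'.range
    rw [hcard] at this
    omega
  have hcore : f'.range.normalCore = ⊥ := by
    have : IsSimpleGroup (alternatingGroup X) := alternatingGroup.isSimpleGroup (by omega)
    refine (IsSimpleGroup.eq_bot_or_eq_top_of_normal _ (Subgroup.normalCore_normal _)).resolve_right
      fun htop => ?_
    have := top_le_iff.1 (htop ▸ Subgroup.normalCore_le f'.range)
    rw [this, Subgroup.index_top] at hidx
    omega
  exact (embeds_subgroup_of_index_eq_six hcore hidx).of_injective f'.rangeRestrict
    (f'.rangeRestrict_injective_iff.2 hf')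

theorem embeds_of_five_dvd_card (h : IsModel G) (h5 : 5 ∣ Nat.card G) : Embeds G := by
  have := h.finite
  obtain ⟨P⟩ := (inferInstance : Nonempty (Sylow 5 G))
  have hP := h.card_sylow_five h5 P
  rcases h.index_normalizer_eq hP with ⟨hidx, hG⟩ | ⟨hidx, hG⟩
  · exact h.embeds_of_sylow_five_normal hP hidx hG
  · have hinj := toPermHom_injective_of_normalCore_eq_bot
      (h.normalCore_normalizer_eq_bot hP (by omega))
    rcases hG with hG | hG | hG
    · exact absurd hG h.card_ne_thirty
    · exact h.embeds_of_card_eq_sixty hidx _ hinj hG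
    · exact embeds_of_card_eq_one_hundred_twenty hidx _ hinj hG

/-! ### Groups of order dividing 24 -/

/-- If they commuted, $c^2a^2$ would have order 6, and every disjunct of `dicyclic12` would fail at
$(c,a)$. -/
theorem not_commute_sq (h : IsModel G) {a c : G} (hc : c ^ 4 = 1) (hc' : c ^ 2 ≠ 1)
    (ha : a ^ 3 = 1) (ha' : a ≠ 1) : ¬Commute (c ^ 2) a := by
  intro hca
  have hmul (n : ℕ) : (c ^ 2 * a ^ 2) ^ n = c ^ (2 * n) * a ^ (2 * n) := by
    rw [(hca.pow_right 2).mul_pow, ← pow_mul, ← pow_mul]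
  have hcpow (n : ℕ) : c ^ (4 * n) = 1 := by rw [pow_mul, hc, one_pow]
  have hapow (n : ℕ) : a ^ (3 * n) = 1 := by rw [pow_mul, ha, one_pow]
  have hc6 : c ^ 6 = c ^ 2 := by
    rw [show 6 = 4 * 1 + 2 by norm_num, pow_add, hcpow, one_mul]
  have hc10 : c ^ 10 = c ^ 2 := by
    rw [show 10 = 4 * 2 + 2 by norm_num, pow_add, hcpow, one_mul]
  have ha10 : a ^ 10 = a := by rw [show 10 = 3 * 3 + 1 by norm_num, pow_add, hapow, one_mul, pow_one]
  rcases h.dicyclic12 c a with h | h | h | h | h | h | h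
  · exact hc' (hc10 ▸ h)
  · exact ha' (ha10 ▸ h)
  · rw [hc, pow_succ, ha, one_mul] at h
    exact ha' h.symm
  · exact hc' (by rw [← hc6, h]; exact hapow 2)
  · rw [hmul, hc6, show 2 * 3 = 3 * 2 by norm_num, hapow, mul_one] at h
    exact hc' h
  · rw [hmul, show 2 * 4 = 4 * 2 by norm_num, hcpow, one_mul] at h
    exact ha' (eq_one_of_pow_eq_one_of_coprime ha h (by norm_num))
  · rw [hmul, hc10, ha10] at h
    have hc2 : c ^ 2 = a⁻¹ := eq_inv_of_mul_eq_one_left h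
    have ha2 : a ^ 2 = 1 := by
      rw [← inv_eq_one, ← inv_pow, ← hc2, ← pow_mul]
      exact hc
    exact ha' (eq_one_of_pow_eq_one_of_coprime ha ha2 (by norm_num))

/-- The elements $as$ and $at$ have order 6, and so does their product $a^2st$ unless $s=t$;
otherwise `abelian12` fails at $(as,at)$. -/
theorem eq_of_commute_of_sq_eq_one (h : IsModel G) {a s t : G} (ha : a ^ 3 = 1) (ha' : a ≠ 1)
    (hs : s ^ 2 = 1) (hs' : s ≠ 1) (ht : t ^ 2 = 1) (ht' : t ≠ 1) (has : Commute a s)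
    (hat : Commute a t) (hst : Commute s t) : s = t := by
  have ha15 : a ^ 15 = 1 := by rw [show 15 = 3 * 5 by norm_num, pow_mul, ha, one_pow]
  have ha4 : a ^ 4 ≠ 1 := fun h => ha' (eq_one_of_pow_eq_one_of_coprime ha h (by norm_num))
  have hsq {s : G} (hs : s ^ 2 = 1) : s ^ 4 = 1 := by
    rw [show 4 = 2 * 2 by norm_num, pow_mul, hs, one_pow]
  have hst2 : (s * t) ^ 2 = 1 := by rw [hst.mul_pow, hs, ht, one_mul]
  have hprod : a * s * (a * t) = a ^ 2 * (s * t) := by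
    rw [mul_assoc, ← mul_assoc s, ← has.eq, sq, mul_assoc, mul_assoc]
  have hcomm : Commute (a ^ 2) (s * t) := (has.mul_right hat).pow_left 2
  rcases h.abelian12 (a * s) (a * t) with h | h | h | h | h | h
  · rw [has.mul_pow, ha15, one_mul, pow_eq_self_of_sq_eq_one hs 7] at h
    exact absurd h hs'
  · rw [hat.mul_pow, ha15, one_mul, pow_eq_self_of_sq_eq_one ht 7] at h
    exact absurd h ht'
  · rw [has.mul_pow, hsq hs, mul_one] at h
    exact absurd h ha4
  · rw [hat.mul_pow, hsq ht, mul_one] at h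
    exact absurd h ha4
  · rw [hprod, hcomm.mul_pow, ← pow_mul, mul_comm, pow_mul, ha15, one_pow, one_mul,
      pow_eq_self_of_sq_eq_one hst2 7, mul_eq_one_iff_eq_inv] at h
    rw [h]
    exact inv_eq_of_mul_eq_one_left (by rw [← sq, ht])
  · rw [hprod, hcomm.mul_pow, hsq hst2, mul_one, ← pow_mul] at h
    exact absurd (eq_one_of_pow_eq_one_of_coprime ha h (by norm_num)) ha'

end IsModel

/-- Squares act trivially on a normal subgroup of order three. -/
theorem commute_sq_of_card_eq_three {G : Type*} [Group G] {P : Subgroup G} [P.Normal]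
    (hP : Nat.card P = 3) (g : G) {a : G} (ha : a ∈ P) : Commute (g ^ 2) a := by
  have : Finite P := Nat.finite_of_card_ne_zero (by omega)
  have : IsCyclic P := isCyclic_of_prime_card hP
  have hcard : Nat.card (MulAut P) = 2 := by
    rw [IsCyclic.card_mulAut, hP]
    decide
  have h1 : MulAut.conjNormal (H := P) (g ^ 2) = 1 := by
    rw [map_pow, ← hcard, pow_card_eq_one']
  have h2 := congrArg Subtype.val (DFunLike.congr_fun h1 (⟨a, ha⟩ : P))
  rw [MulAut.conjNormal_apply] at h2
  exact mul_inv_eq_iff_eq_mul.1 h2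

namespace IsModel

variable {G : Type*} [Group G]

theorem eq_one_or_eq_of_mem_zpowers {a b : G} (hb : b ^ 2 = 1) (ha : a ∈ Subgroup.zpowers b) :
    a = 1 ∨ a = b := by
  obtain ⟨n, rfl⟩ := Subgroup.mem_zpowers_iff.1 ha
  have hb' : b ^ (2 : ℤ) = 1 := by exact_mod_cast hb
  rcases Int.even_or_odd' n with ⟨k, rfl | rfl⟩
  · exact .inl (by rw [zpow_mul, hb', one_zpow])
  · exact .inr (by rw [zpow_add, zpow_mul, hb', one_zpow, one_mul, zpow_one])

/-- Sylow subgroups for 3 and 2 are disjoint and have indices 2 and 3. -/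
theorem embeds_of_card_eq_six (h : IsModel G) (hG : Nat.card G = 6) : Embeds G := by
  have := h.finite
  obtain ⟨P⟩ := (inferInstance : Nonempty (Sylow 3 G))
  obtain ⟨Q⟩ := (inferInstance : Nonempty (Sylow 2 G))
  have hP : Nat.card P = 3 := h.card_sylow_three (by rw [hG]; norm_num) P
  have hdisj : Disjoint (P : Subgroup G) Q := IsPGroup.disjoint_of_ne 3 2 (by norm_num) _ _ P.2 Q.2
  refine embeds_of_index_add_index_le (K := P) (L := Q)
    (disjoint_iff.1 (hdisj.mono_left (Subgroup.normalCore_le _))) ?_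
  have h1 := Subgroup.card_mul_index (P : Subgroup G)
  have h2 := Subgroup.card_mul_index (Q : Subgroup G)
  have h3 : 2 ∣ Nat.card Q := Q.dvd_card_of_dvd_card (by rw [hG]; norm_num)
  have h4 : (Q : Subgroup G).index ∣ 3 := by
    obtain ⟨k, hk⟩ := h3
    refine ⟨k, ?_⟩
    rw [hk, hG, mul_assoc] at h2
    rw [mul_comm]
    omega
  have h5 := Nat.le_of_dvd (by norm_num) h4
  rw [hP] at h1
  omega

/-- The group is dihedral, and the reflection $b$ generates a core-free subgroup of index 4: were it
normal, $b$ would commute with $c$, which it inverts. -/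
theorem embeds_of_card_eq_eight (h : IsModel G) (hG : Nat.card G = 8) : Embeds G := by
  have := h.finite
  have hfour := h.pow_four_eq_one (IsPGroup.of_card (p := 2) (n := 3) hG)
  obtain ⟨c, hc⟩ : ∃ c : G, c ^ 2 ≠ 1 := by
    by_contra! hsq
    have := h.card_le_four_of_sq_eq_one hsq
    omega
  obtain ⟨b, hb⟩ : ∃ b, b ∉ Subgroup.zpowers c := by
    by_contra! htop
    have h1 := Nat.card_zpowers c
    rw [(Subgroup.eq_top_iff' _).2 htop, Subgroup.card_top, orderOf_eq_four hfour hc] at h1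
    omega
  obtain ⟨hb2, hbc⟩ := h.sq_eq_one_and_conj_eq_inv hfour hc hb
  have hb1 : b ≠ 1 := fun h => hb (h ▸ one_mem _)
  refine embeds_of_index_le (K := Subgroup.zpowers b) ?_ ?_
  · refine (Subgroup.eq_bot_iff_forall _).2 fun m hm => ?_
    refine (eq_one_or_eq_of_mem_zpowers hb2 (Subgroup.normalCore_le _ hm)).resolve_right ?_
    rintro rfl
    have h1 := Subgroup.normalCore_le _ ((Subgroup.normalCore_normal _).conj_mem _ hm c)
    rcases eq_one_or_eq_of_mem_zpowers hb2 h1 with h1 | h1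
    · exact hb1 (conj_eq_one_iff.1 h1)
    · rw [mul_inv_eq_iff_eq_mul] at h1
      rw [← h1, mul_inv_cancel_right, eq_inv_iff_mul_eq_one, ← sq] at hbc
      exact hc hbc
  · have h1 := Subgroup.card_mul_index (Subgroup.zpowers b)
    rw [Nat.card_zpowers, orderOf_eq_prime hb2 hb1, hG] at h1
    omega

theorem index_normalizer_sylow_three (h : IsModel G) (h24 : Nat.card G ∣ 24) {P : Sylow 3 G}
    (hP : Nat.card P = 3) :
    (Subgroup.normalizer (P : Set G)).index = 1 ∨
      (Subgroup.normalizer (P : Set G)).index = 4 := by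
  have := h.finite
  have hmod := card_sylow_modEq_one 3 G
  rw [P.card_eq_index_normalizer, Nat.ModEq] at hmod
  have hmul := Subgroup.card_mul_index (Subgroup.normalizer (P : Set G))
  obtain ⟨k, hk⟩ : 3 ∣ Nat.card (Subgroup.normalizer (P : Set G)) :=
    hP.symm.dvd.trans (Subgroup.card_dvd_of_le Subgroup.le_normalizer)
  rw [hk] at hmul
  rw [← hmul] at h24
  generalize (Subgroup.normalizer (P : Set G)).index = n at *
  have hn : n ∣ 8 := by
    refine Nat.dvd_of_mul_dvd_mul_left (k := 3) (by norm_num) (dvd_trans ⟨k, ?_⟩ h24)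
    ring
  have hn' : n ≤ 8 := Nat.le_of_dvd (by norm_num) hn
  interval_cases n <;> omega

/-- Squares centralize $P$, so by `not_commute_sq` the Sylow 2-subgroup $Q$ has exponent 2, and by
`eq_of_commute_of_sq_eq_one` some $s\in Q$ does not centralize $P$. The points are the three cosets
of $Q$ and the two of $P\langle s\rangle$. An element of both the core of $Q$ and $P\langle
s\rangle$ lies in $\langle s\rangle$ and centralizes $P$, so it is 1. -/
theorem embeds_of_card_eq_twelve_of_normal (h : IsModel G) (hG : Nat.card G = 12) {P : Sylow 3 G}
    (hP : Nat.card P = 3) (hnormal : (P : Subgroup G).Normal) : Embeds G := by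
  have := h.finite
  obtain ⟨a, haP, ha, ha3⟩ := exists_ne_one_pow_eq_one (by norm_num) hP
  obtain ⟨Q⟩ := (inferInstance : Nonempty (Sylow 2 G))
  have hQ : 4 ∣ Nat.card Q :=
    Q.pow_dvd_card_of_pow_dvd_card (n := 2) (by rw [hG]; norm_num)
  have hQidx : (Q : Subgroup G).index ≤ 3 := by
    have h1 := Subgroup.card_mul_index (Q : Subgroup G)
    obtain ⟨k, hk⟩ := hQ
    refine Nat.le_of_dvd (by norm_num) ⟨k, ?_⟩
    rw [hk, hG, mul_assoc] at h1
    rw [mul_comm]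
    omega
  have hsq (q : G) (hq : q ∈ Q) : q ^ 2 = 1 := by
    by_contra hq2
    have hq4 : q ^ 4 = 1 :=
      congrArg Subtype.val ((h.subgroup Q).pow_four_eq_one Q.2 ⟨q, hq⟩)
    exact h.not_commute_sq hq4 hq2 ha3 ha (commute_sq_of_card_eq_three hP q haP)
  have hQcomm {q r : G} (hq : q ∈ Q) (hr : r ∈ Q) : Commute q r := by
    have hinv {q : G} (hq : q ∈ Q) : q⁻¹ = q :=
      inv_eq_of_mul_eq_one_left (by rw [← sq, hsq q hq])
    rw [Commute, SemiconjBy, ← hinv (mul_mem hq hr), mul_inv_rev, hinv hq, hinv hr]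
  obtain ⟨s, hsQ, hs⟩ : ∃ s ∈ Q, ¬Commute a s := by
    by_contra! hcomm
    have hcard : Nat.card Q ≤ 2 := by
      by_contra! hcard
      have hnt : 2 < ((Q : Subgroup G) : Set G).ncard := hcard
      obtain ⟨x, hx, hx1⟩ := Set.exists_mem_notMem_of_ncard_lt_ncard
        (s := {1}) (t := ((Q : Subgroup G) : Set G)) (by rw [Set.ncard_singleton]; omega)
      obtain ⟨y, hy, hy1⟩ := Set.exists_mem_notMem_of_ncard_lt_ncard
        (s := {1, x}) (t := ((Q : Subgroup G) : Set G))
        ((Set.ncard_insert_le _ _).trans_lt (by rw [Set.ncard_singleton]; omega))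
      simp only [Set.mem_insert_iff, Set.mem_singleton_iff, not_or] at hx1 hy1
      exact hy1.2 (h.eq_of_commute_of_sq_eq_one ha3 ha (hsq y hy) hy1.1 (hsq x hx) hx1
        (hcomm y hy) (hcomm x hx) (hQcomm hy hx))
    have := Nat.le_of_dvd Nat.card_pos hQ
    omega
  have hdisj : Disjoint (P : Subgroup G) Q := IsPGroup.disjoint_of_ne 3 2 (by norm_num) _ _ P.2 Q.2
  refine embeds_of_index_add_index_le (K := Q) (L := (P : Subgroup G) ⊔ Subgroup.zpowers s) ?_ ?_
  · refine (Subgroup.eq_bot_iff_forall _).2 fun m hm => ?_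
    obtain ⟨hmcore, hmL⟩ := Subgroup.mem_inf.1 hm
    have hmQ : m ∈ (Q : Subgroup G) := Subgroup.normalCore_le _ hmcore
    obtain ⟨u, hu, v, hv, rfl⟩ := Subgroup.mem_sup_of_normal_left.1 hmL
    have hvQ : v ∈ (Q : Subgroup G) := (Subgroup.zpowers_le.2 hsQ) hv
    have hu1 : u = 1 :=
      Subgroup.disjoint_def.1 hdisj hu ((Subgroup.mul_mem_cancel_right _ hvQ).1 hmQ)
    rw [hu1, one_mul] at hmcore ⊢
    refine (eq_one_or_eq_of_mem_zpowers (hsq s hsQ) hv).resolve_right ?_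
    rintro rfl
    exact hs (Subgroup.commute_of_normal_of_disjoint _ _ hnormal (Subgroup.normalCore_normal _)
      (hdisj.mono_right (Subgroup.normalCore_le _)) a v haP hmcore)
  · have h3 : 3 ∣ Nat.card ((P : Subgroup G) ⊔ Subgroup.zpowers s : Subgroup G) :=
      hP.symm.dvd.trans (Subgroup.card_dvd_of_le le_sup_left)
    have h2 : 2 ∣ Nat.card ((P : Subgroup G) ⊔ Subgroup.zpowers s : Subgroup G) := by
      have hs1 : s ≠ 1 := fun h => hs (h ▸ Commute.one_right a)
      rw [← orderOf_eq_prime (hsq s hsQ) hs1, ← Nat.card_zpowers]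
      exact Subgroup.card_dvd_of_le le_sup_right
    have h1 := Subgroup.card_mul_index ((P : Subgroup G) ⊔ Subgroup.zpowers s)
    obtain ⟨k, hk⟩ : 6 ∣ Nat.card ((P : Subgroup G) ⊔ Subgroup.zpowers s : Subgroup G) :=
      Nat.Coprime.mul_dvd_of_dvd_of_dvd (by norm_num : Nat.Coprime 2 3) h2 h3
    have hle : ((P : Subgroup G) ⊔ Subgroup.zpowers s).index ≤ 2 := by
      refine Nat.le_of_dvd (by norm_num) ⟨k, ?_⟩
      rw [hk, hG, mul_assoc] at h1
      rw [mul_comm]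
      omega
    omega

/-- If $P$ is not normal, it is its own normalizer, and the action on its four cosets is faithful.
-/
theorem embeds_of_card_eq_twelve (h : IsModel G) (hG : Nat.card G = 12) : Embeds G := by
  have := h.finite
  obtain ⟨P⟩ := (inferInstance : Nonempty (Sylow 3 G))
  have hP := h.card_sylow_three (by rw [hG]; norm_num) P
  rcases h.index_normalizer_sylow_three (by rw [hG]; norm_num) hP with hidx | hidx
  · exact h.embeds_of_card_eq_twelve_of_normal hG hP
      (Subgroup.normalizer_eq_top_iff.1 (Subgroup.index_eq_one.1 hidx))
  · refine embeds_of_index_le (K := Subgroup.normalizer (P : Set G)) ?_ (by omega)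
    have hN : Nat.card (Subgroup.normalizer (P : Set G)) = 3 := by
      have := Subgroup.card_mul_index (Subgroup.normalizer (P : Set G))
      rw [hidx, hG] at this
      omega
    have hPN : (P : Subgroup G) = Subgroup.normalizer (P : Set G) :=
      Subgroup.eq_of_le_of_card_ge Subgroup.le_normalizer (by rw [hN]; exact hP.ge)
    have hbot := normalCore_normalizer_inf_eq_bot hP (by omega)
    rwa [inf_eq_left.2 ((Subgroup.normalCore_le _).trans hPN.ge)] at hbot

/-- There is an element $c$ of order 4, so $P$ is not normal and $G$ permutes four Sylow
3-subgroups. The kernel $M$ has order at most 2. A nontrivial $z\in M$ would commute with $c$ and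
$P$, with $z\ne c^2$ by `not_commute_sq`, and then `fourCycles` would fail at $(c,cz)$. -/
theorem embeds_of_card_eq_twenty_four (h : IsModel G) (hG : Nat.card G = 24) : Embeds G := by
  have := h.finite
  obtain ⟨P⟩ := (inferInstance : Nonempty (Sylow 3 G))
  have hP := h.card_sylow_three (by rw [hG]; norm_num) P
  obtain ⟨a, haP, ha, ha3⟩ := exists_ne_one_pow_eq_one (by norm_num) hP
  obtain ⟨c, hc4, hc⟩ : ∃ c : G, c ^ 4 = 1 ∧ c ^ 2 ≠ 1 := by
    obtain ⟨Q⟩ := (inferInstance : Nonempty (Sylow 2 G))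
    have hQ : 8 ∣ Nat.card Q :=
      Q.pow_dvd_card_of_pow_dvd_card (n := 3) (by rw [hG]; norm_num)
    by_contra! hsq
    have hle := (h.subgroup Q).card_le_four_of_sq_eq_one fun q => by
      have := hsq q (by exact_mod_cast (h.subgroup Q).pow_four_eq_one Q.2 q)
      exact_mod_cast this
    have := Nat.le_of_dvd Nat.card_pos hQ
    omega
  rcases h.index_normalizer_sylow_three (by rw [hG]) hP with hidx | hidx
  · have : (P : Subgroup G).Normal :=
      Subgroup.normalizer_eq_top_iff.1 (Subgroup.index_eq_one.1 hidx)
    exact absurd (commute_sq_of_card_eq_three hP c haP) (h.not_commute_sq hc4 hc ha3 ha)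
  · have hidx1 : (Subgroup.normalizer (P : Set G)).index ≠ 1 := by omega
    have hbot := normalCore_normalizer_inf_eq_bot hP hidx1
    have hcomm {m b : G} := commute_of_mem_normalCore_normalizer hP hidx1 (m := m) (a := b)
    refine embeds_of_index_le (K := Subgroup.normalizer (P : Set G)) ?_ (by omega)
    have hN : Nat.card (Subgroup.normalizer (P : Set G)) = 6 := by
      have := Subgroup.card_mul_index (Subgroup.normalizer (P : Set G))
      rw [hidx, hG] at this
      omega
    have hMN := Subgroup.normalCore_le (Subgroup.normalizer (P : Set G))
    have hMnormal := Subgroup.normalCore_normal (Subgroup.normalizer (P : Set G))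
    have hMcard : Nat.card (Subgroup.normalizer (P : Set G)).normalCore ∣ 2 := by
      have hdvd : Nat.card (Subgroup.normalizer (P : Set G)).normalCore ∣ 6 :=
        (Subgroup.card_dvd_of_le hMN).trans hN.dvd
      refine Nat.Coprime.dvd_of_dvd_mul_left (m := 3) ?_ hdvd
      refine Nat.coprime_comm.1 ((Nat.Prime.coprime_iff_not_dvd Nat.prime_three).2 fun h3 => ?_)
      -- An element of order 3 in the core normalizes $P$, hence lies in $P$, which meets the core
      -- trivially.
      obtain ⟨u, hu⟩ := exists_prime_orderOf_dvd_card' 3 h3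
      have hu' : orderOf (u : G) = 3 := by rw [Subgroup.orderOf_coe, hu]
      have hpg : IsPGroup 3 (Subgroup.zpowers (u : G)) :=
        IsPGroup.of_card (n := 1) (by rw [Nat.card_zpowers, hu', pow_one])
      have huP : (u : G) ∈ Subgroup.zpowers (u : G) ⊓ P := by
        rw [← hpg.inf_normalizer_sylow P]
        exact Subgroup.mem_inf.2 ⟨Subgroup.mem_zpowers _, hMN u.2⟩
      have hu1 : (u : G) = 1 := by
        rw [← Subgroup.mem_bot, ← hbot]
        exact Subgroup.mem_inf.2 ⟨u.2, (Subgroup.mem_inf.1 huP).2⟩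
      rw [hu1, orderOf_one] at hu'
      omega
    generalize (Subgroup.normalizer (P : Set G)).normalCore = M at *
    refine (Subgroup.eq_bot_iff_forall _).2 fun z hz => ?_
    by_contra hz1
    have hMsq {m : G} (hm : m ∈ M) : m ^ 2 = 1 := by
      have : (⟨m, hm⟩ : M) ^ 2 = 1 :=
        orderOf_dvd_iff_pow_eq_one.1 ((orderOf_dvd_natCard _).trans hMcard)
      exact congrArg Subtype.val this
    have hzc : Commute z c := by
      have hMz : M = Subgroup.zpowers z := by
        refine (Subgroup.eq_of_le_of_card_ge (Subgroup.zpowers_le.2 hz) ?_).symm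
        rw [Nat.card_zpowers, orderOf_eq_prime (hMsq hz) hz1]
        exact Nat.le_of_dvd (by norm_num) hMcard
      have h1 := hMnormal.conj_mem z hz c
      rw [hMz] at h1
      rcases eq_one_or_eq_of_mem_zpowers (hMsq hz) h1 with h1 | h1
      · exact absurd (conj_eq_one_iff.1 h1) hz1
      · exact (mul_inv_eq_iff_eq_mul.1 h1).symm
    have hc2 : c ^ 2 ≠ z := fun h2 =>
      h.not_commute_sq hc4 hc ha3 ha (h2 ▸ hcomm hz haP)
    have hz2 := hMsq hz
    have hc30 : c ^ 30 = c ^ 2 := by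
      rw [show 30 = 4 * 7 + 2 by norm_num, pow_add, pow_mul, hc4, one_pow, one_mul]
    -- The three products are $c^2z$, $c^3$ and $z$, of orders 2, 4 and 2, so none has trivial 15th
    -- power.
    rcases h.fourCycles c (c * z) with h | h | h | h | h
    · exact hc (hc30 ▸ h)
    · rw [hzc.symm.mul_pow, hc30, show 30 = 2 * 15 by norm_num, pow_mul, hz2, one_pow,
        mul_one] at h
      exact hc h
    · have h4 : (c * (c * z)) ^ 2 = 1 := by
        rw [← mul_assoc, ← sq, (hzc.symm.pow_left 2).mul_pow, ← pow_mul, hc4, hz2, one_mul]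
      rw [pow_eq_self_of_sq_eq_one h4 7, ← mul_assoc, ← sq, mul_eq_one_iff_eq_inv] at h
      exact hc2 (h.trans (inv_eq_of_mul_eq_one_left (by rw [← sq, hz2])))
    · rw [hzc.symm.mul_pow, hz2, mul_one, ← pow_succ', ← pow_mul] at h
      have hc1 := eq_one_of_pow_eq_one_of_coprime hc4 h (by norm_num)
      exact hc (by rw [hc1, one_pow])
    · rw [hzc.symm.mul_pow, ← mul_assoc, ← pow_succ', hc4, one_mul,
        pow_eq_self_of_sq_eq_one hz2 1, pow_eq_self_of_sq_eq_one hz2 7] at h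
      exact hz1 h

theorem embeds (h : IsModel G) : Embeds G := by
  have := h.finite
  by_cases h5 : 5 ∣ Nat.card G
  · exact h.embeds_of_five_dvd_card h5
  have h24 : Nat.card G ∣ 24 :=
    Nat.Coprime.dvd_of_dvd_mul_left
      (Nat.coprime_comm.1 ((Nat.Prime.coprime_iff_not_dvd Nat.prime_five).2 h5))
      (show Nat.card G ∣ 5 * 24 from h.card_dvd)
  have hle : Nat.card G ≤ 24 := Nat.le_of_dvd (by norm_num) h24
  by_cases h4 : Nat.card G ≤ 5
  · exact embeds_of_card_le h4
  have hcases : Nat.card G = 6 ∨ Nat.card G = 8 ∨ Nat.card G = 12 ∨ Nat.card G = 24 := by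
    generalize Nat.card G = n at *
    interval_cases n <;> omega
  rcases hcases with hG | hG | hG | hG
  · exact h.embeds_of_card_eq_six hG
  · exact h.embeds_of_card_eq_eight hG
  · exact h.embeds_of_card_eq_twelve hG
  · exact h.embeds_of_card_eq_twenty_four hG

end IsModel

end DisjunctiveIdentity

theorem theorem2 :
    DisjunctiveIdentity.IsBasisOfDIdentities.{0, v} (Equiv.Perm (Fin 5))
      {DisjunctiveIdentity.omega 120,
        DisjunctiveIdentity.exponents456,
        DisjunctiveIdentity.fourCycles,
        DisjunctiveIdentity.elementaryAbelian8,
        DisjunctiveIdentity.order9,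
        DisjunctiveIdentity.abelian12,
        DisjunctiveIdentity.dicyclic12,
        DisjunctiveIdentity.order25} := by
  open DisjunctiveIdentity in
  refine ⟨?_, fun H _ hH => (isModel_of_satisfies (hH _ ?_) (hH _ ?_) (hH _ ?_) (hH _ ?_)
    (hH _ ?_) (hH _ ?_) (hH _ ?_) (hH _ ?_)).embeds.inDVar⟩
  · rintro δ (rfl | rfl | rfl | rfl | rfl | rfl | rfl | rfl)
    exacts [satisfies_omega, satisfies_exponents456, satisfies_fourCycles,
      satisfies_elementaryAbelian8, satisfies_order9, satisfies_abelian12, satisfies_dicyclic12,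
      satisfies_order25]
  all_goals simp
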